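/- For every language $L\subseteq\{0,1\}^*$ there is a bounded-error public-coin interactive proof system for $L$ with classical messages whose verifier is a two-way finite automaton with quantum and classical states (2qcfa) with two qubits, i.e. four quantum states, and whose expected runtime on inputs of length $n$ is $2^{2^{O(n)}}$. Here a 2qcfa verifier consists of finite sets of classical states (some accepting, some rejecting, none both), prover symbols and outcomes, an initial classical state, an initial quantum state, and transition rules. The input $w$ is written between two end-markers on a read-only two-way tape. In each step the prover sends one symbol; the current classical state, the scanned tape symbol and the prover's symbol determine a superoperator $\{E_1,\dots,E_k\}$ of $4\times 4$ matrices with arbitrary (possibly uncomputable) complex entries and $\sum_i E_i^\dagger E_i=I$. It is applied to the quantum register: from the unit vector $\psi$, outcome $i$ is observed with probability $\|E_i\psi\|^2$ and the register becomes $E_i\psi/\|E_i\psi\|$. The same data together with $i$ determine the next classical state and the head move. The computation halts on entering an accepting or rejecting state. A prover strategy is any function from the input and the sequence of outcomes observed so far (the public coins) to the next symbol. Precisely: for every $L\subseteq\{0,1\}^*$ there are such a verifier $V$, a prover strategy $P$, a real $\varepsilon\in[0,1/2)$ and a function $f:\mathbb N\to\mathbb N$ with $f(n)=O(n)$ such that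 (1) for every $w\in L$, $V$ interacting with $P$ accepts $w$ with probability at least $1-\varepsilon$; (2) for every $w\notin L$ and every prover strategy $P'$, $V$ interacting with $P'$ rejects $w$ with probability at least $1-\varepsilon$; and (3) for every input $w$ and every prover strategy $P'$, the expected number of steps until $V$ halts is at most $2^{2^{f(|w|)}}$. -/

import Mathlib

open scoped ENNReal Matrix

namespace QCFA

/-- Contents of a tape square: an end-marker, or a letter of the input. -/
inductive TapeSym (A : Type) : Type
  | leftEnd : TapeSym A
  | letter (a : A) : TapeSym A
  | rightEnd : TapeSym A

/-- Head movements. -/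
inductive Dir : Type
  | left : Dir
  | stay : Dir
  | right : Dir

/-- The symbol on square `p` of the tape that holds `w` between the two end-markers:
square `0` holds the left end-marker, squares `1, …, |w|` hold `w`, and square `|w| + 1`
holds the right end-marker. -/
def scan {A : Type} (w : List A) : ℕ → TapeSym A
  | 0 => TapeSym.leftEnd
  | p + 1 =>
    match w[p]? with
    | some a => TapeSym.letter a
    | none => TapeSym.rightEnd

/-- The head position after a move. -/
def Dir.move : Dir → ℕ → ℕ
  | Dir.left, p => p - 1
  | Dir.stay, p => p
  | Dir.right, p => p + 1

/-- A two-way finite automaton with quantum and classical states, with `j` quantum states and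
arbitrary complex amplitudes, used as the verifier of a proof system with classical messages.
The superoperator applied in a step depends on the classical state, the scanned symbol and the
symbol sent by the prover in that step; the next classical state and the head movement depend on
these and on the observed outcome. All superoperators share one finite set of outcomes; unused
outcomes have the zero matrix as their operation element. -/
structure Verifier (A : Type) (j : ℕ) where
  /-- classical states -/
  State : Type
  /-- symbols the prover may send -/
  Msg : Type
  /-- outcomes of the superoperators -/
  Outcome : Type
  [finiteState : Finite State]
  [finiteMsg : Finite Msg]
  [fintypeOutcome : Fintype Outcome]
  /-- initial classical state -/
  start : State
  /-- initial quantum state -/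
  qstart : Fin j
  accepting : Set State
  rejecting : Set State
  disjoint_verdicts : Disjoint accepting rejecting
  /-- operation elements -/
  op : State → TapeSym A → Msg → Outcome → Matrix (Fin j) (Fin j) ℂ
  complete : ∀ q σ m, ∑ i, (op q σ m i)ᴴ * op q σ m i = 1
  /-- classical transition function -/
  next : State → TapeSym A → Msg → Outcome → State × Dir
  /-- the head never leaves the tape -/
  next_leftEnd : ∀ q m i, (next q TapeSym.leftEnd m i).2 ≠ Dir.left
  next_rightEnd : ∀ q m i, (next q TapeSym.rightEnd m i).2 ≠ Dir.right

attribute [instance] Verifier.finiteState Verifier.finiteMsg Verifier.fintypeOutcome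

/-- A configuration. The register holds the unnormalized superposition: the product of the
operation elements of the outcomes observed so far, applied to the initial superposition.
Its squared norm is thus the probability of observing that sequence of outcomes. -/
structure Config {A : Type} {j : ℕ} (V : Verifier A j) where
  state : V.State
  head : ℕ
  reg : Fin j → ℂ

variable {A : Type} {j : ℕ}

namespace Verifier

/-- A prover strategy. The coins are public: given the input and the list of all outcomes
observed so far (most recent first), the strategy determines the next symbol to be sent.
There is no computability restriction. -/
def Prover (V : Verifier A j) : Type := List A → List V.Outcome → V.Msg

def initConfig (V : Verifier A j) : Config V where
  state := V.start
  head := 0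
  reg := Pi.single V.qstart 1

/-- One step on input `w`, when the prover sends `m` and the outcome `i` is observed. -/
def step (V : Verifier A j) (w : List A) (c : Config V) (m : V.Msg) (i : V.Outcome) :
    Config V where
  state := (V.next c.state (scan w c.head) m i).1
  head := (V.next c.state (scan w c.head) m i).2.move c.head
  reg := V.op c.state (scan w c.head) m i *ᵥ c.reg

/-- The configuration reached on input `w` with prover `P` after the outcomes `h`
(most recent first). -/
def run (V : Verifier A j) (P : V.Prover) (w : List A) : List V.Outcome → Config V
  | [] => V.initConfig
  | i :: h => V.step w (V.run P w h) (P w h) i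

/-- The classical state is neither accepting nor rejecting. -/
def Running (V : Verifier A j) (c : Config V) : Prop :=
  c.state ∉ V.accepting ∧ c.state ∉ V.rejecting

/-- The outcomes `h` can be produced in full: the computation has not halted
before the last of them. -/
def Feasible (V : Verifier A j) (P : V.Prover) (w : List A) : List V.Outcome → Prop
  | [] => True
  | _ :: h => V.Feasible P w h ∧ V.Running (V.run P w h)

/-- The probability of observing the outcomes `h` (for a feasible `h`). -/
noncomputable def prob (V : Verifier A j) (P : V.Prover) (w : List A) (h : List V.Outcome) :
    ℝ≥0∞ :=
  ∑ x, ‖(V.run P w h).reg x‖ₑ ^ 2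

/-- The probability that the verifier halts in an accepting state. -/
noncomputable def acceptProb (V : Verifier A j) (P : V.Prover) (w : List A) : ℝ≥0∞ :=
  ∑' h : {h : List V.Outcome // V.Feasible P w h ∧ (V.run P w h).state ∈ V.accepting},
    V.prob P w h

/-- The probability that the verifier halts in a rejecting state. -/
noncomputable def rejectProb (V : Verifier A j) (P : V.Prover) (w : List A) : ℝ≥0∞ :=
  ∑' h : {h : List V.Outcome // V.Feasible P w h ∧ (V.run P w h).state ∈ V.rejecting},
    V.prob P w h

/-- The probability that the verifier has not halted within `t` steps. -/
noncomputable def survivalProb (V : Verifier A j) (P : V.Prover) (w : List A) (t : ℕ) : ℝ≥0∞ :=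
  ∑' h : {h : List V.Outcome // h.length = t ∧ V.Feasible P w h ∧ V.Running (V.run P w h)},
    V.prob P w h

/-- The expected number `T` of steps until the verifier halts, as `∑ₜ Pr[T > t]`; it is infinite
if the verifier fails to halt with positive probability. -/
noncomputable def expectedRuntime (V : Verifier A j) (P : V.Prover) (w : List A) : ℝ≥0∞ :=
  ∑' t : ℕ, V.survivalProb P w t

/-- The verifier `V` with the honest prover `P` is a bounded-error public-coin interactive proof
system for `L`: for some error bound `ε < 1/2`, members are accepted with probability at least
`1 - ε` when `P` is followed, and nonmembers are rejected with probability at least `1 - ε`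
whatever the prover does. -/
def IsBoundedErrorProofSystem (V : Verifier A j) (P : V.Prover) (L : Language A) : Prop :=
  ∃ ε : ℝ, 0 ≤ ε ∧ ε < 1 / 2 ∧
    (∀ w ∈ L, ENNReal.ofReal (1 - ε) ≤ V.acceptProb P w) ∧
    (∀ w ∉ L, ∀ P' : V.Prover, ENNReal.ofReal (1 - ε) ≤ V.rejectProb P' w)

end Verifier

end QCFA

/-!
Every language is encoded in the amplitudes of a verifier with four quantum states. Words are
numbered by `code w`, the number with binary expansion `1w`, and `d t` tells whether the word with
number `t` is in the language; the real number `α = tail d 0` has the base-`5` digits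
`d 1, d 2, …` after the point.

The computation consists of rounds. In a round the prover sends the values `1, 2, …, code w` of a
counter, each in one sweep of the head over the tape, so that it has as many bits as the tape has
squares for them, and after each value `t` the digit `d t`. Up to a common factor, the register
holds `1`, the remainder `5 ^ s * α - …` of `α` after the `s` digits sent so far (as a difference
from `α`, so that the round can start in a basis state), the last counter value `s`, and the value
of the bits read in the current sweep. These numbers change by linear maps (`readOp`, `shiftOp`).
The maps are scaled to contractions and completed to superoperators by outcomes that reset the
register and start a new round (`exists_completion`, `resetOp`). At the end of each sweep an outcome
whose amplitude is a multiple of the difference between the counter and the successor of its last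
value leads to rejection (`miscountOp`). When the counter equals `code w`, which the finite control
notices by comparing bits with the tape, the digit `1` is shifted out, an outcome whose amplitude is
a multiple of the remainder leads to rejection (`misdigitOp`), and otherwise, if the round is not
abandoned, the verifier accepts.

* If `w` is in the language and the prover is honest, the counter test never fires and the final
  remainder is at most `1 / 4`, so rejection is less likely than acceptance by a constant factor.
* If `w` is not in the language, then every accepting round contains a wrong counter value, where
  the rejecting amplitude exceeds that of all later acceptance, or a wrong digit. A wrong digit
  moves the remainder to absolute value at least `3 / 4`, where it stays (`remainder_step`), and the
  final test rejects with the larger probability.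
* Without a counter fault a round reaches `code w` in `code w < 2 ^ (n + 1)` sweeps of `n + 2`
  steps. So every round, whatever the prover does, halts with probability at least
  `256 ^ (-(n + 2) * 2 ^ (n + 1))` up to a constant. This gives the doubly exponential runtime, and
  it shows that the verifier halts almost surely, so that a bound on one of the two verdict
  probabilities gives a bound on the other (`Verifier.one_le_acceptProb_add_rejectProb`).

Each of the three bounds is proved by a function on configurations that does not increase on
average (`Verifier.tsum_running_add_tsum_halted_le`): `honestPotential`, `soundPotential` and
`runtimePotential`. Such a function compares the two verdicts within a round, and treats all mass
lost to restarts alike.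
-/

namespace QCFA

/-! ### Sums over histories -/

section Histories

variable {O : Type}

/-- The sum of `f` over all lists of length `t`. -/
noncomputable def levelSum (t : ℕ) (f : List O → ℝ≥0∞) : ℝ≥0∞ :=
  ∑' h : {h : List O // h.length = t}, f h

theorem levelSum_zero (f : List O → ℝ≥0∞) : levelSum 0 f = f [] := by
  unfold levelSum
  have : Unique {h : List O // h.length = 0} :=
    ⟨⟨⟨[], rfl⟩⟩, fun a => Subtype.ext (List.length_eq_zero_iff.1 a.2)⟩
  rw [tsum_eq_single (⟨[], rfl⟩ : {h : List O // h.length = 0})]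
  intro b hb
  exact absurd (Subsingleton.elim _ _) hb

/-- A nonempty list of length `t + 1` is a head followed by a list of length `t`. -/
def consLengthEquiv (t : ℕ) :
    {h : List O // h.length = t} × O ≃ {h : List O // h.length = t + 1} where
  toFun p := ⟨p.2 :: p.1.1, by simp [p.1.2]⟩
  invFun h := (⟨h.1.tail, by simp [h.2]⟩,
    h.1.head (by intro h0; have := h.2; simp [h0] at this))
  left_inv p := by simp
  right_inv h := by simp

/-- Histories grow at the head of the list, so a history of length `t + 1` extends one of
length `t`. -/
theorem levelSum_succ [Fintype O] (t : ℕ) (f : List O → ℝ≥0∞) :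
    levelSum (t + 1) f = levelSum t fun h => ∑ i, f (i :: h) := by
  unfold levelSum
  refine ((consLengthEquiv t).tsum_eq _).symm.trans
    ((ENNReal.tsum_prod (f := fun (h : {h : List O // h.length = t}) i => f (i :: h.1))).trans ?_)
  simp [tsum_fintype]

theorem levelSum_mono {t : ℕ} {f g : List O → ℝ≥0∞} (hfg : ∀ h, f h ≤ g h) :
    levelSum t f ≤ levelSum t g :=
  ENNReal.tsum_le_tsum fun h => hfg h

theorem levelSum_add (t : ℕ) (f g : List O → ℝ≥0∞) :
    levelSum t (fun h => f h + g h) = levelSum t f + levelSum t g :=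
  ENNReal.tsum_add

theorem tsum_levelSum (f : List O → ℝ≥0∞) : ∑' t, levelSum t f = ∑' h, f h := by
  unfold levelSum
  rw [← ENNReal.tsum_sigma, ← (Equiv.sigmaFiberEquiv (List.length (α := O))).tsum_eq]
  rfl

end Histories

/-! ### Potential functions on configurations -/

namespace Verifier

variable {A : Type} {j : ℕ} (V : Verifier A j) (P : V.Prover) (w : List A)

/-- The histories after which the computation is still running. -/
def RunningSet : Set (List V.Outcome) := {h | V.Feasible P w h ∧ V.Running (V.run P w h)}

/-- The histories that end in a halting configuration. -/
def HaltedSet : Set (List V.Outcome) := {h | V.Feasible P w h ∧ ¬ V.Running (V.run P w h)}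

theorem feasible_indicator (f : List V.Outcome → ℝ≥0∞) (h : List V.Outcome) :
    {h | V.Feasible P w h}.indicator f h
      = (V.RunningSet P w).indicator f h + (V.HaltedSet P w).indicator f h := by
  by_cases h1 : V.Feasible P w h <;> by_cases h2 : V.Running (V.run P w h) <;>
    simp [RunningSet, HaltedSet, h1, h2, Set.indicator]

theorem feasible_indicator_cons (f : List V.Outcome → ℝ≥0∞) (h : List V.Outcome) :
    ∑ i, {h | V.Feasible P w h}.indicator f (i :: h)
      = (V.RunningSet P w).indicator (fun h => ∑ i, f (i :: h)) h := by
  by_cases h1 : h ∈ V.RunningSet P w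
  · rw [Set.indicator_of_mem h1]
    exact Finset.sum_congr rfl fun i _ => Set.indicator_of_mem (s := {h | V.Feasible P w h}) h1 f
  · rw [Set.indicator_of_notMem h1]
    exact Finset.sum_eq_zero fun i _ =>
      Set.indicator_of_notMem (s := {h | V.Feasible P w h}) h1 f

/-- Optional stopping for supermartingales: if `Φ` decreases on average by `g` in every step, then
the total of `g` over all running histories and of `Φ` over all halted ones is at most the initial
value of `Φ`. -/
theorem tsum_running_add_tsum_halted_le (g Φ : List V.Outcome → ℝ≥0∞)
    (hstep : ∀ h ∈ V.RunningSet P w, g h + ∑ i, Φ (i :: h) ≤ Φ h) :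
    ∑' h, (V.RunningSet P w).indicator g h + ∑' h, (V.HaltedSet P w).indicator Φ h ≤ Φ [] := by
  have key : ∀ T : ℕ, ∑ t ∈ Finset.range T, (levelSum t ((V.RunningSet P w).indicator g)
        + levelSum t ((V.HaltedSet P w).indicator Φ))
      + levelSum T ({h | V.Feasible P w h}.indicator Φ) ≤ Φ [] := by
    intro T
    induction T with
    | zero =>
      rw [levelSum_zero, Set.indicator_of_mem (show [] ∈ {h | V.Feasible P w h} from trivial)]
      simp
    | succ T ih =>
      refine le_trans ?_ ih
      have h1 : levelSum T ({h | V.Feasible P w h}.indicator Φ)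
          = levelSum T ((V.RunningSet P w).indicator Φ)
            + levelSum T ((V.HaltedSet P w).indicator Φ) := by
        rw [← levelSum_add]
        exact congrArg _ (funext fun h => V.feasible_indicator P w Φ h)
      have h2 : levelSum T ((V.RunningSet P w).indicator g)
            + levelSum (T + 1) ({h | V.Feasible P w h}.indicator Φ)
          ≤ levelSum T ((V.RunningSet P w).indicator Φ) := by
        rw [levelSum_succ, ← levelSum_add]
        refine levelSum_mono fun h => ?_
        rw [feasible_indicator_cons]
        by_cases hh : h ∈ V.RunningSet P w
        · simpa [hh] using hstep h hh
        · simp [hh]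
      rw [Finset.sum_range_succ, h1]
      calc _ = ∑ t ∈ Finset.range T, (levelSum t ((V.RunningSet P w).indicator g)
              + levelSum t ((V.HaltedSet P w).indicator Φ))
            + ((levelSum T ((V.RunningSet P w).indicator g)
              + levelSum (T + 1) ({h | V.Feasible P w h}.indicator Φ))
            + levelSum T ((V.HaltedSet P w).indicator Φ)) := by ring
        _ ≤ _ := by gcongr
  rw [← tsum_levelSum, ← tsum_levelSum, ← ENNReal.tsum_add, ENNReal.tsum_eq_iSup_nat]
  exact iSup_le fun T => le_trans le_self_add (key T)

theorem expectedRuntime_eq_tsum :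
    V.expectedRuntime P w = ∑' h, (V.RunningSet P w).indicator (V.prob P w) h := by
  rw [← tsum_levelSum]
  refine tsum_congr fun t => ?_
  unfold survivalProb levelSum
  refine (tsum_subtype {h : List V.Outcome | h.length = t ∧ V.Feasible P w h ∧
    V.Running (V.run P w h)} (V.prob P w)).trans (Eq.trans ?_
      (tsum_subtype {h : List V.Outcome | h.length = t} _).symm)
  refine tsum_congr fun h => ?_
  rw [Set.indicator_indicator]
  rfl

theorem acceptProb_eq_tsum : V.acceptProb P w
    = ∑' h, {h | V.Feasible P w h ∧ (V.run P w h).state ∈ V.accepting}.indicator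
        (V.prob P w) h :=
  tsum_subtype {h | V.Feasible P w h ∧ (V.run P w h).state ∈ V.accepting} (V.prob P w)

theorem rejectProb_eq_tsum : V.rejectProb P w
    = ∑' h, {h | V.Feasible P w h ∧ (V.run P w h).state ∈ V.rejecting}.indicator
        (V.prob P w) h :=
  tsum_subtype {h | V.Feasible P w h ∧ (V.run P w h).state ∈ V.rejecting} (V.prob P w)

theorem expectedRuntime_le_of_potential (Φ : Config V → ℝ≥0∞)
    (hstep : ∀ h, V.Running (V.run P w h) →
      V.prob P w h + ∑ i, Φ (V.step w (V.run P w h) (P w h) i) ≤ Φ (V.run P w h)) :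
    V.expectedRuntime P w ≤ Φ V.initConfig := by
  rw [expectedRuntime_eq_tsum]
  exact le_trans le_self_add (V.tsum_running_add_tsum_halted_le P w (V.prob P w)
    (fun h => Φ (V.run P w h)) fun h hh => hstep h hh.2)

theorem acceptProb_le_of_potential (Φ : Config V → ℝ≥0∞)
    (hacc : ∀ h, (V.run P w h).state ∈ V.accepting → V.prob P w h ≤ Φ (V.run P w h))
    (hstep : ∀ h, V.Running (V.run P w h) →
      ∑ i, Φ (V.step w (V.run P w h) (P w h) i) ≤ Φ (V.run P w h)) :
    V.acceptProb P w ≤ Φ V.initConfig := by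
  refine le_trans ?_ (V.tsum_running_add_tsum_halted_le P w (fun _ => 0)
    (fun h => Φ (V.run P w h)) fun h hh => by simpa using! hstep h hh.2)
  rw [acceptProb_eq_tsum]
  refine le_trans (ENNReal.tsum_le_tsum fun h => ?_) le_add_self
  refine Set.indicator_le (fun h hh => ?_) h
  rw [Set.indicator_of_mem]
  · exact hacc h hh.2
  · exact ⟨hh.1, fun hr => hr.1 hh.2⟩

theorem rejectProb_le_of_potential (Φ : Config V → ℝ≥0∞)
    (hrej : ∀ h, (V.run P w h).state ∈ V.rejecting → V.prob P w h ≤ Φ (V.run P w h))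
    (hstep : ∀ h, V.Running (V.run P w h) →
      ∑ i, Φ (V.step w (V.run P w h) (P w h) i) ≤ Φ (V.run P w h)) :
    V.rejectProb P w ≤ Φ V.initConfig := by
  refine le_trans ?_ (V.tsum_running_add_tsum_halted_le P w (fun _ => 0)
    (fun h => Φ (V.run P w h)) fun h hh => by simpa using! hstep h hh.2)
  rw [rejectProb_eq_tsum]
  refine le_trans (ENNReal.tsum_le_tsum fun h => ?_) le_add_self
  refine Set.indicator_le (fun h hh => ?_) h
  rw [Set.indicator_of_mem]
  · exact hrej h hh.2
  · exact ⟨hh.1, fun hr => hr.2 hh.2⟩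

end Verifier

/-! ### Conservation of probability -/

/-- The squared Euclidean norm of a register. -/
noncomputable def mass {j : ℕ} (ψ : Fin j → ℂ) : ℝ := ∑ x, ‖ψ x‖ ^ 2

theorem mass_nonneg {j : ℕ} (ψ : Fin j → ℂ) : 0 ≤ mass ψ :=
  Finset.sum_nonneg fun _ _ => by positivity

theorem ofReal_mass {j : ℕ} (ψ : Fin j → ℂ) :
    ENNReal.ofReal (mass ψ) = ∑ x, ‖ψ x‖ₑ ^ 2 := by
  unfold mass
  rw [ENNReal.ofReal_sum_of_nonneg fun _ _ => by positivity]
  refine Finset.sum_congr rfl fun x _ => ?_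
  rw [ENNReal.ofReal_pow (norm_nonneg _), ofReal_norm]

theorem coe_mass {j : ℕ} (ψ : Fin j → ℂ) : (mass ψ : ℂ) = star ψ ⬝ᵥ ψ := by
  simp [mass, dotProduct, ← Complex.normSq_eq_conj_mul_self, Complex.normSq_eq_norm_sq]

theorem coe_mass_mulVec {j : ℕ} (M : Matrix (Fin j) (Fin j) ℂ) (ψ : Fin j → ℂ) :
    (mass (M *ᵥ ψ) : ℂ) = star ψ ⬝ᵥ ((Mᴴ * M) *ᵥ ψ) := by
  rw [coe_mass, Matrix.star_mulVec, ← Matrix.dotProduct_mulVec, Matrix.mulVec_mulVec]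

/-- The operation elements of a superoperator distribute the mass of the register. -/
theorem sum_mass_mulVec {j : ℕ} {ι : Type} [Fintype ι] (E : ι → Matrix (Fin j) (Fin j) ℂ)
    (ψ : Fin j → ℂ) (hE : ∑ i, (E i)ᴴ * E i = 1) : ∑ i, mass (E i *ᵥ ψ) = mass ψ := by
  have : ((∑ i, mass (E i *ᵥ ψ) : ℝ) : ℂ) = (mass ψ : ℝ) := by
    push_cast
    simp_rw [coe_mass_mulVec]
    rw [← dotProduct_sum, ← Matrix.sum_mulVec, hE, Matrix.one_mulVec, coe_mass]
  exact_mod_cast this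

namespace Verifier

variable {A : Type} {j : ℕ} (V : Verifier A j) (P : V.Prover) (w : List A)

theorem prob_eq (h : List V.Outcome) :
    V.prob P w h = ENNReal.ofReal (mass (V.run P w h).reg) :=
  (ofReal_mass _).symm

theorem sum_mass_step (c : Config V) (m : V.Msg) :
    ∑ i, mass (V.step w c m i).reg = mass c.reg :=
  sum_mass_mulVec _ _ (V.complete c.state (scan w c.head) m)

theorem sum_prob_cons (h : List V.Outcome) :
    ∑ i, V.prob P w (i :: h) = V.prob P w h := by
  simp_rw [prob_eq]
  rw [← ENNReal.ofReal_sum_of_nonneg fun _ _ => mass_nonneg _]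
  exact congrArg _ (V.sum_mass_step w _ _)

theorem prob_nil : V.prob P w [] = 1 := by
  unfold prob
  rw [Finset.sum_eq_single V.qstart]
  · simp [run, initConfig]
  · intro b _ hb
    simp [run, initConfig, Pi.single_eq_of_ne hb]
  · simp

/-- A computation with finite expected runtime halts with probability one. -/
theorem one_le_acceptProb_add_rejectProb (hfin : V.expectedRuntime P w ≠ ⊤) :
    1 ≤ V.acceptProb P w + V.rejectProb P w := by
  have key : ∀ T : ℕ, 1 ≤ ∑ t ∈ Finset.range T,
        levelSum t ((V.HaltedSet P w).indicator (V.prob P w))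
      + levelSum T ({h | V.Feasible P w h}.indicator (V.prob P w)) := by
    intro T
    induction T with
    | zero =>
      rw [levelSum_zero, Set.indicator_of_mem (show [] ∈ {h | V.Feasible P w h} from trivial)]
      simp [prob_nil]
    | succ T ih =>
      refine ih.trans (le_of_eq ?_)
      rw [Finset.sum_range_succ, levelSum_succ, add_assoc, ← levelSum_add]
      refine congrArg _ (congrArg _ (funext fun h => ?_))
      rw [feasible_indicator, feasible_indicator_cons, add_comm]
      simp_rw [sum_prob_cons]
  have hsplit : ∑' h, (V.HaltedSet P w).indicator (V.prob P w) h
      ≤ V.acceptProb P w + V.rejectProb P w := by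
    rw [acceptProb_eq_tsum, rejectProb_eq_tsum, ← ENNReal.tsum_add]
    refine ENNReal.tsum_le_tsum fun h => ?_
    by_cases h1 : V.Feasible P w h <;> by_cases h2 : (V.run P w h).state ∈ V.accepting <;>
      by_cases h3 : (V.run P w h).state ∈ V.rejecting <;>
      simp [HaltedSet, Running, Set.indicator, h1, h2, h3]
  have hbound : ∀ T : ℕ, 1 ≤ V.acceptProb P w + V.rejectProb P w
      + levelSum T ((V.RunningSet P w).indicator (V.prob P w)) := by
    intro T
    refine (key T).trans ?_
    have h1 : levelSum T ({h | V.Feasible P w h}.indicator (V.prob P w))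
        = levelSum T ((V.HaltedSet P w).indicator (V.prob P w))
          + levelSum T ((V.RunningSet P w).indicator (V.prob P w)) := by
      rw [← levelSum_add]
      exact congrArg _ (funext fun h => by rw [feasible_indicator, add_comm])
    rw [h1, ← add_assoc, ← Finset.sum_range_succ]
    gcongr
    refine le_trans ?_ hsplit
    rw [← tsum_levelSum]
    exact ENNReal.sum_le_tsum _
  rw [expectedRuntime_eq_tsum, ← tsum_levelSum] at hfin
  have hlim := (ENNReal.tendsto_atTop_zero_of_tsum_ne_top hfin).const_add
    (V.acceptProb P w + V.rejectProb P w)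
  rw [add_zero] at hlim
  exact ge_of_tendsto' hlim hbound

/-- The head stays between the end-markers. -/
theorem step_head_le {c : Config V} (hc : c.head ≤ w.length + 1) (m : V.Msg) (i : V.Outcome) :
    (V.step w c m i).head ≤ w.length + 1 := by
  change (V.next c.state (scan w c.head) m i).2.move c.head ≤ w.length + 1
  rcases hc.lt_or_eq with h | h
  · cases (V.next c.state (scan w c.head) m i).2 <;> simp only [Dir.move] <;> omega
  · have hs : scan w c.head = TapeSym.rightEnd := by simp [h, scan]
    have := V.next_rightEnd c.state m i
    rw [hs]
    revert this
    cases (V.next c.state TapeSym.rightEnd m i).2 <;> simp only [Dir.move] <;> intro h <;>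
      first | omega | exact absurd rfl h

theorem run_head_le (h : List V.Outcome) : (V.run P w h).head ≤ w.length + 1 := by
  induction h with
  | nil => exact Nat.zero_le _
  | cons i h ih => exact V.step_head_le w ih _ _

end Verifier

/-! ### Numbering the inputs -/

/-- The bit that a tape square contributes to the code of the input: the left end-marker stands
for the leading `1`. -/
def bitOf : TapeSym Bool → Bool
  | .leftEnd => true
  | .letter b => b
  | .rightEnd => false

/-- The number whose binary digits stand on the first `p` squares of the tape. -/
def prefixCode (w : List Bool) : ℕ → ℕ
  | 0 => 0
  | p + 1 => 2 * prefixCode w p + (bitOf (scan w p)).toNat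

/-- The number with binary expansion `1w`. -/
def code (w : List Bool) : ℕ := prefixCode w (w.length + 1)

theorem scan_succ_of_lt {A : Type} {w : List A} {p : ℕ} (hp : p < w.length) :
    scan w (p + 1) = .letter w[p] := by
  simp [scan, hp]

theorem scan_length_add_one {A : Type} (w : List A) : scan w (w.length + 1) = .rightEnd := by
  simp [scan]

theorem scan_ne_rightEnd {A : Type} {w : List A} {p : ℕ} (hp : p ≤ w.length) :
    scan w p ≠ .rightEnd := by
  cases p with
  | zero => simp [scan]
  | succ p => simp [scan_succ_of_lt (show p < w.length from hp)]

theorem scan_ne_leftEnd {A : Type} {w : List A} {p : ℕ} (hp : p ≠ 0) :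
    scan w p ≠ .leftEnd := by
  obtain ⟨p, rfl⟩ := Nat.exists_eq_succ_of_ne_zero hp
  cases h : w[p]? <;> simp [scan, h]

theorem prefixCode_lt (w : List Bool) (p : ℕ) : prefixCode w p < 2 ^ p := by
  induction p with
  | zero => simp [prefixCode]
  | succ p ih =>
    have := Bool.toNat_le (bitOf (scan w p))
    rw [prefixCode, pow_succ]
    omega

theorem le_prefixCode_succ (w : List Bool) (p : ℕ) : 2 ^ p ≤ prefixCode w (p + 1) := by
  induction p with
  | zero => simp [prefixCode, scan, bitOf]
  | succ p ih =>
    rw [prefixCode, pow_succ]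
    omega

theorem code_pos (w : List Bool) : 0 < code w :=
  (Nat.two_pow_pos _).trans_le (le_prefixCode_succ w _)

theorem code_injective : Function.Injective code := by
  intro w w' h
  have hlen : w.length = w'.length := by
    have h1 := le_prefixCode_succ w w.length
    have h2 := prefixCode_lt w (w.length + 1)
    have h3 := le_prefixCode_succ w' w'.length
    have h4 := prefixCode_lt w' (w'.length + 1)
    simp only [code] at h
    have h5 := (Nat.pow_lt_pow_iff_right (a := 2) (by norm_num)).1 (h1.trans_lt (h ▸ h4))
    have h6 := (Nat.pow_lt_pow_iff_right (a := 2) (by norm_num)).1 (h3.trans_lt (h ▸ h2))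
    omega
  have hpre : ∀ k ≤ w.length + 1,
      prefixCode w (w.length + 1 - k) = prefixCode w' (w.length + 1 - k) := by
    intro k
    induction k with
    | zero =>
      intro _
      simpa [code, hlen] using h
    | succ k ih =>
      intro hk
      have h1 := ih (by omega)
      rw [show w.length + 1 - k = (w.length + 1 - (k + 1)) + 1 by omega, prefixCode,
        prefixCode] at h1
      have h2 := Bool.toNat_le (bitOf (scan w (w.length + 1 - (k + 1))))
      have h3 := Bool.toNat_le (bitOf (scan w' (w.length + 1 - (k + 1))))
      omega
  refine List.ext_getElem hlen fun i hi hi' => ?_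
  have h1 := hpre (w.length + 1 - (i + 2)) (by omega)
  have h2 := hpre (w.length + 1 - (i + 1)) (by omega)
  rw [show w.length + 1 - (w.length + 1 - (i + 2)) = i + 1 + 1 by omega, prefixCode.eq_2 w (i + 1),
    prefixCode.eq_2 w' (i + 1)] at h1
  rw [show w.length + 1 - (w.length + 1 - (i + 1)) = i + 1 by omega] at h2
  rw [h2, scan_succ_of_lt hi, scan_succ_of_lt hi'] at h1
  simp only [bitOf] at h1
  have h3 : w[i].toNat = w'[i].toNat := by omega
  revert h3
  cases w[i] <;> cases w'[i] <;> simp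

/-! ### A language as a real number -/

/-- The real number whose base-`5` expansion has the digits `d (s + 1), d (s + 2), …` after the
point. -/
noncomputable def tail (d : ℕ → Bool) (s : ℕ) : ℝ :=
  ∑' i : ℕ, ((d (s + 1 + i)).toNat : ℝ) * (1 / 5) ^ (i + 1)

theorem toNat_cast_nonneg_le (b : Bool) : 0 ≤ (b.toNat : ℝ) ∧ (b.toNat : ℝ) ≤ 1 := by
  cases b <;> simp

theorem hasSum_geometric_fifth : HasSum (fun i : ℕ => ((1 : ℝ) / 5) ^ (i + 1)) (1 / 4) := by
  have h := (hasSum_geometric_of_lt_one (r := (1 : ℝ) / 5) (by norm_num) (by norm_num)).mul_left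
    (1 / 5)
  simp_rw [← pow_succ'] at h
  rwa [show (1 : ℝ) / 5 * (1 - 1 / 5)⁻¹ = 1 / 4 by norm_num] at h

theorem tail_term_le (d : ℕ → Bool) (s i : ℕ) :
    ((d (s + 1 + i)).toNat : ℝ) * (1 / 5) ^ (i + 1) ≤ (1 / 5) ^ (i + 1) :=
  mul_le_of_le_one_left (by positivity) (toNat_cast_nonneg_le _).2

theorem summable_tail (d : ℕ → Bool) (s : ℕ) :
    Summable fun i : ℕ => ((d (s + 1 + i)).toNat : ℝ) * (1 / 5) ^ (i + 1) :=
  Summable.of_nonneg_of_le (fun _ => by positivity) (tail_term_le d s)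
    hasSum_geometric_fifth.summable

theorem tail_nonneg (d : ℕ → Bool) (s : ℕ) : 0 ≤ tail d s :=
  tsum_nonneg fun _ => by positivity

theorem tail_le (d : ℕ → Bool) (s : ℕ) : tail d s ≤ 1 / 4 := by
  rw [← hasSum_geometric_fifth.tsum_eq]
  exact (summable_tail d s).tsum_le_tsum (tail_term_le d s) hasSum_geometric_fifth.summable

theorem five_mul_tail (d : ℕ → Bool) (s : ℕ) :
    5 * tail d s = (d (s + 1)).toNat + tail d (s + 1) := by
  unfold tail
  rw [(summable_tail d s).tsum_eq_zero_add, mul_add, ← tsum_mul_left]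
  congr 1
  · simp
    ring
  · refine tsum_congr fun i => ?_
    rw [show s + 1 + (i + 1) = s + 1 + 1 + i by ring]
    ring

/-! ### Completing contractions to superoperators -/

open scoped MatrixOrder ComplexOrder Matrix.Norms.L2Operator in
theorem exists_completion {j : ℕ} {ι : Type} [Fintype ι] (C : ι → Matrix (Fin j) (Fin j) ℂ)
    (hC : ∀ ψ, ∑ i, mass (C i *ᵥ ψ) ≤ mass ψ) :
    ∃ B : Matrix (Fin j) (Fin j) ℂ, ∑ i, (C i)ᴴ * C i + Bᴴ * B = 1 := by
  have hpos : (1 - ∑ i, (C i)ᴴ * C i).PosSemidef := by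
    refine .of_dotProduct_mulVec_nonneg ?_ fun ψ => ?_
    · simp [Matrix.IsHermitian, Matrix.conjTranspose_sub, Matrix.conjTranspose_sum]
    · rw [Matrix.sub_mulVec, Matrix.one_mulVec, dotProduct_sub, Matrix.sum_mulVec, dotProduct_sum]
      simp_rw [← coe_mass_mulVec]
      rw [← coe_mass, ← Complex.ofReal_sum, ← Complex.ofReal_sub, Complex.zero_le_real]
      linarith [hC ψ]
  obtain ⟨B, hB⟩ := CStarAlgebra.nonneg_iff_eq_star_mul_self.mp hpos.nonneg
  exact ⟨B, by rw [← Matrix.star_eq_conjTranspose B, ← hB]; abel⟩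

/-- The matrix that sends `ψ` to the multiple of the first basis vector by the `k`-th entry of
`B ψ`. -/
def resetOp {j : ℕ} (B : Matrix (Fin (j + 1)) (Fin (j + 1)) ℂ) (k : Fin (j + 1)) :
    Matrix (Fin (j + 1)) (Fin (j + 1)) ℂ :=
  Matrix.of fun x y => if x = 0 then B k y else 0

theorem resetOp_mulVec {j : ℕ} (B : Matrix (Fin (j + 1)) (Fin (j + 1)) ℂ) (k : Fin (j + 1))
    (ψ : Fin (j + 1) → ℂ) : resetOp B k *ᵥ ψ = Pi.single 0 ((B *ᵥ ψ) k) := by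
  ext x
  by_cases hx : x = 0
  · subst hx
    simp [resetOp, Matrix.mulVec, dotProduct]
  · simp [resetOp, Matrix.mulVec, dotProduct, hx]

theorem sum_resetOp {j : ℕ} (B : Matrix (Fin (j + 1)) (Fin (j + 1)) ℂ) :
    ∑ k, (resetOp B k)ᴴ * resetOp B k = Bᴴ * B := by
  ext x y
  simp [Matrix.sum_apply, Matrix.mul_apply, resetOp, Fin.sum_univ_succ]

/-! ### The verifier -/

/-- The classical states. In `sweep e` the head moves to the right, and `e` tells whether the bits
sent so far agree with the tape; in `rewind` it returns to the left end-marker. -/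
inductive Phase : Type
  | sweep (e : Bool)
  | rewind
  | accept
  | reject

instance : Finite Phase :=
  Finite.of_injective
    (fun q : Phase => match q with
      | .sweep e => (Sum.inl e : Bool ⊕ Fin 3)
      | .rewind => Sum.inr 0
      | .accept => Sum.inr 1
      | .reject => Sum.inr 2)
    (by rintro (_ | _) (_ | _) h <;> simp_all)

/-- The outcomes: the round goes on, a fault of the counter or of the digits is detected, or the
round is abandoned. -/
inductive Coin : Type
  | advance
  | miscount
  | misdigit
  | restart (k : Fin 4)

/-- The outcomes, split into the essential ones and the restarts. -/
def coinEquiv : Fin 3 ⊕ Fin 4 ≃ Coin where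
  toFun
    | .inl 0 => .advance
    | .inl 1 => .miscount
    | .inl 2 => .misdigit
    | .inr k => .restart k
  invFun
    | .advance => .inl 0
    | .miscount => .inl 1
    | .misdigit => .inl 2
    | .restart k => .inr k
  left_inv i := by
    rcases i with i | k
    · fin_cases i <;> rfl
    · rfl
  right_inv i := by cases i <;> rfl

instance : Fintype Coin := Fintype.ofEquiv _ coinEquiv

theorem sum_coin {M : Type} [AddCommMonoid M] (f : Coin → M) :
    ∑ i, f i = f .advance + f .miscount + f .misdigit + ∑ k, f (.restart k) := by
  rw [← coinEquiv.sum_comp, Fintype.sum_sum_type, Fin.sum_univ_three]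
  rfl

/-- Appends a bit to the counter being read. -/
noncomputable def readOp (m : Bool) : Matrix (Fin 4) (Fin 4) ℂ :=
  (1 / 16 : ℂ) • !![1, 0, 0, 0; 0, 1, 0, 0; 0, 0, 1, 0; (m.toNat : ℂ), 0, 0, 2]

/-- Shifts the digit `d` out of the real number, which is stored as a difference from `α`, and
saves the counter. -/
noncomputable def shiftOp (α : ℝ) (d : Bool) : Matrix (Fin 4) (Fin 4) ℂ :=
  (1 / 16 : ℂ) • !![1, 0, 0, 0; ((4 * α - d.toNat : ℝ) : ℂ), 5, 0, 0; 0, 0, 0, 1; 0, 0, 0, 0]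

/-- Measures by how much the counter differs from the successor of its last value. -/
noncomputable def miscountOp : Matrix (Fin 4) (Fin 4) ℂ :=
  (1 / 8 : ℂ) • !![-1, 0, -1, 1; 0, 0, 0, 0; 0, 0, 0, 0; 0, 0, 0, 0]

/-- Measures what remains of the real number after the digit `1` has been shifted out. -/
noncomputable def misdigitOp (α : ℝ) : Matrix (Fin 4) (Fin 4) ℂ :=
  (1 / 8 : ℂ) • !![((5 * α - 1 : ℝ) : ℂ), 5, 0, 0; 0, 0, 0, 0; 0, 0, 0, 0; 0, 0, 0, 0]

/-- Keeps the first amplitude only. -/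
noncomputable def acceptOp : Matrix (Fin 4) (Fin 4) ℂ :=
  (1 / 16 : ℂ) • !![1, 0, 0, 0; 0, 0, 0, 0; 0, 0, 0, 0; 0, 0, 0, 0]

/-- The operation elements of the outcomes `advance`, `miscount` and `misdigit`. The tests have
twice the scale of the other maps, so that a counter fault is rejected with at least four times the
probability of a later acceptance in the same round. The scale `1 / 16` makes the masses add up to
at most the mass of the register, and bounds that of `advance` in a sweep by half of it. -/
noncomputable def core (α : ℝ) : Phase → TapeSym Bool → Bool → Fin 3 → Matrix (Fin 4) (Fin 4) ℂ
  | .sweep true, .rightEnd, _ => ![acceptOp, miscountOp, misdigitOp α]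
  | .sweep false, .rightEnd, d => ![shiftOp α d, miscountOp, 0]
  | .sweep _, _, m => ![readOp m, 0, 0]
  | _, _, _ => ![1, 0, 0]

theorem readOp_mulVec (m : Bool) (ψ : Fin 4 → ℂ) :
    readOp m *ᵥ ψ = (1 / 16 : ℂ) • ![ψ 0, ψ 1, ψ 2, m.toNat * ψ 0 + 2 * ψ 3] := by
  rw [readOp, Matrix.smul_mulVec]
  congr 1
  ext x
  fin_cases x <;> simp [Matrix.mulVec, dotProduct, Fin.sum_univ_four]

theorem shiftOp_mulVec (α : ℝ) (d : Bool) (ψ : Fin 4 → ℂ) :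
    shiftOp α d *ᵥ ψ
      = (1 / 16 : ℂ) • ![ψ 0, ((4 * α - d.toNat : ℝ) : ℂ) * ψ 0 + 5 * ψ 1, ψ 3, 0] := by
  rw [shiftOp, Matrix.smul_mulVec]
  congr 1
  ext x
  fin_cases x <;> simp [Matrix.mulVec, dotProduct, Fin.sum_univ_four]

theorem miscountOp_mulVec (ψ : Fin 4 → ℂ) :
    miscountOp *ᵥ ψ = (1 / 8 : ℂ) • ![ψ 3 - ψ 2 - ψ 0, 0, 0, 0] := by
  rw [miscountOp, Matrix.smul_mulVec]
  congr 1
  ext x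
  fin_cases x <;> simp [Matrix.mulVec, dotProduct, Fin.sum_univ_four]
  ring

theorem misdigitOp_mulVec (α : ℝ) (ψ : Fin 4 → ℂ) :
    misdigitOp α *ᵥ ψ
      = (1 / 8 : ℂ) • ![((5 * α - 1 : ℝ) : ℂ) * ψ 0 + 5 * ψ 1, 0, 0, 0] := by
  rw [misdigitOp, Matrix.smul_mulVec]
  congr 1
  ext x
  fin_cases x <;> simp [Matrix.mulVec, dotProduct, Fin.sum_univ_four]

theorem acceptOp_mulVec (ψ : Fin 4 → ℂ) :
    acceptOp *ᵥ ψ = (1 / 16 : ℂ) • ![ψ 0, 0, 0, 0] := by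
  rw [acceptOp, Matrix.smul_mulVec]
  congr 1
  ext x
  fin_cases x <;> simp [Matrix.mulVec, dotProduct, Fin.sum_univ_four]

theorem mass_four (ψ : Fin 4 → ℂ) :
    mass ψ = ‖ψ 0‖ ^ 2 + ‖ψ 1‖ ^ 2 + ‖ψ 2‖ ^ 2 + ‖ψ 3‖ ^ 2 := by
  rw [mass, Fin.sum_univ_four]

theorem mass_vec (a b c d : ℂ) :
    mass ![a, b, c, d] = ‖a‖ ^ 2 + ‖b‖ ^ 2 + ‖c‖ ^ 2 + ‖d‖ ^ 2 := by
  rw [mass_four]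
  rfl

theorem mass_smul {j : ℕ} (z : ℂ) (ψ : Fin j → ℂ) : mass (z • ψ) = ‖z‖ ^ 2 * mass ψ := by
  simp [mass, mul_pow, Finset.mul_sum]

theorem mass_zero {j : ℕ} : mass (0 : Fin j → ℂ) = 0 := by
  simp [mass]

theorem norm_mul_add_sq_le (r : ℝ) (y z : ℂ) {R : ℝ} (hr : |r| ≤ R) :
    ‖(r : ℂ) * y + 5 * z‖ ^ 2 ≤ (R ^ 2 + 25) * (‖y‖ ^ 2 + ‖z‖ ^ 2) := by
  have h : ‖(r : ℂ) * y + 5 * z‖ ≤ R * ‖y‖ + 5 * ‖z‖ := by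
    refine (norm_add_le _ _).trans ?_
    rw [norm_mul, norm_mul, Complex.norm_real, Real.norm_eq_abs]
    norm_num
    gcongr
  nlinarith [pow_le_pow_left₀ (norm_nonneg _) h 2, sq_nonneg (5 * ‖y‖ - R * ‖z‖)]

theorem mass_readOp_le (m : Bool) (ψ : Fin 4 → ℂ) : mass (readOp m *ᵥ ψ) ≤ 1 / 2 * mass ψ := by
  have h : ‖(m.toNat : ℂ) * ψ 0 + 2 * ψ 3‖ ≤ ‖ψ 0‖ + 2 * ‖ψ 3‖ := by
    refine (norm_add_le _ _).trans ?_
    cases m <;> simp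
  rw [readOp_mulVec, mass_smul, mass_vec, mass_four]
  norm_num
  nlinarith [pow_le_pow_left₀ (norm_nonneg _) h 2, sq_nonneg (2 * ‖ψ 0‖ - ‖ψ 3‖),
    sq_nonneg ‖ψ 0‖, sq_nonneg ‖ψ 1‖, sq_nonneg ‖ψ 2‖, sq_nonneg ‖ψ 3‖]

theorem mass_miscountOp_le (ψ : Fin 4 → ℂ) :
    mass (miscountOp *ᵥ ψ) ≤ 1 / 16 * mass ψ := by
  have h : ‖ψ 3 - ψ 2 - ψ 0‖ ≤ ‖ψ 3‖ + ‖ψ 2‖ + ‖ψ 0‖ :=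
    (norm_sub_le _ _).trans (by gcongr; exact norm_sub_le _ _)
  rw [miscountOp_mulVec, mass_smul, mass_vec, mass_four]
  norm_num
  nlinarith [pow_le_pow_left₀ (norm_nonneg _) h 2, sq_nonneg (‖ψ 3‖ - ‖ψ 2‖),
    sq_nonneg (‖ψ 3‖ - ‖ψ 0‖), sq_nonneg (‖ψ 2‖ - ‖ψ 0‖), sq_nonneg ‖ψ 0‖, sq_nonneg ‖ψ 1‖,
    sq_nonneg ‖ψ 2‖, sq_nonneg ‖ψ 3‖]

theorem mass_shiftOp_le {α : ℝ} (hα : 0 ≤ α ∧ α ≤ 1 / 4) (d : Bool) (ψ : Fin 4 → ℂ) :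
    mass (shiftOp α d *ᵥ ψ) ≤ 1 / 4 * mass ψ := by
  have hd := toNat_cast_nonneg_le d
  have h := norm_mul_add_sq_le (4 * α - d.toNat) (ψ 0) (ψ 1) (R := 1)
    (abs_le.2 ⟨by linarith, by linarith⟩)
  rw [shiftOp_mulVec, mass_smul, mass_vec, mass_four]
  norm_num at h ⊢
  nlinarith [sq_nonneg ‖ψ 0‖, sq_nonneg ‖ψ 1‖, sq_nonneg ‖ψ 2‖, sq_nonneg ‖ψ 3‖]

theorem mass_misdigitOp_le {α : ℝ} (hα : 0 ≤ α ∧ α ≤ 1 / 4) (ψ : Fin 4 → ℂ) :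
    mass (misdigitOp α *ᵥ ψ) ≤ 7 / 16 * mass ψ := by
  have h := norm_mul_add_sq_le (5 * α - 1) (ψ 0) (ψ 1) (R := 1)
    (abs_le.2 ⟨by linarith, by linarith⟩)
  rw [misdigitOp_mulVec, mass_smul, mass_vec, mass_four]
  norm_num at h ⊢
  nlinarith [sq_nonneg ‖ψ 0‖, sq_nonneg ‖ψ 1‖, sq_nonneg ‖ψ 2‖, sq_nonneg ‖ψ 3‖]

theorem mass_acceptOp_le (ψ : Fin 4 → ℂ) : mass (acceptOp *ᵥ ψ) ≤ 1 / 256 * mass ψ := by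
  rw [acceptOp_mulVec, mass_smul, mass_vec, mass_four]
  norm_num
  linarith [sq_nonneg ‖ψ 1‖, sq_nonneg ‖ψ 2‖, sq_nonneg ‖ψ 3‖]

theorem core_sweep {α : ℝ} {σ : TapeSym Bool} (hσ : σ ≠ .rightEnd) (e m : Bool) :
    core α (.sweep e) σ m = ![readOp m, 0, 0] := by
  cases σ <;> cases e <;> first | rfl | exact absurd rfl hσ

theorem sum_mass_core_le {α : ℝ} (hα : 0 ≤ α ∧ α ≤ 1 / 4) (q : Phase) (σ : TapeSym Bool)
    (m : Bool) (ψ : Fin 4 → ℂ) : ∑ i, mass (core α q σ m i *ᵥ ψ) ≤ mass ψ := by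
  have h0 := mass_nonneg ψ
  rw [Fin.sum_univ_three]
  rcases q with e | _ | _ | _
  · by_cases hσ : σ = .rightEnd
    · subst hσ
      cases e
      · simp [core, mass_zero]
        linarith [mass_shiftOp_le hα m ψ, mass_miscountOp_le ψ]
      · simp [core]
        linarith [mass_acceptOp_le ψ, mass_miscountOp_le ψ, mass_misdigitOp_le hα ψ]
    · simp [core_sweep hσ, mass_zero]
      linarith [mass_readOp_le m ψ]
  all_goals simp [core, mass_zero]

/-- A matrix that completes the operation elements `core` to a superoperator. -/
noncomputable def completion (α : Set.Icc (0 : ℝ) (1 / 4)) (q : Phase) (σ : TapeSym Bool)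
    (m : Bool) : Matrix (Fin 4) (Fin 4) ℂ :=
  (exists_completion _ (sum_mass_core_le α.2 q σ m)).choose

theorem completion_spec (α : Set.Icc (0 : ℝ) (1 / 4)) (q : Phase) (σ : TapeSym Bool) (m : Bool) :
    ∑ i, (core α q σ m i)ᴴ * core α q σ m i
      + (completion α q σ m)ᴴ * completion α q σ m = 1 :=
  (exists_completion _ (sum_mass_core_le α.2 q σ m)).choose_spec

/-- The operation elements of the verifier. A restart resets the register to a multiple of the
initial superposition. -/
noncomputable def coinOp (α : Set.Icc (0 : ℝ) (1 / 4)) (q : Phase) (σ : TapeSym Bool) (m : Bool) :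
    Coin → Matrix (Fin 4) (Fin 4) ℂ
  | .advance => core α q σ m 0
  | .miscount => core α q σ m 1
  | .misdigit => core α q σ m 2
  | .restart k => resetOp (completion α q σ m) k

/-- The classical transition function of the verifier. -/
def nextPhase : Phase → TapeSym Bool → Bool → Coin → Phase × Dir
  | .accept, _, _, _ => (.accept, .stay)
  | .reject, _, _, _ => (.reject, .stay)
  | _, _, _, .restart _ => (.rewind, .stay)
  | _, _, _, .miscount => (.reject, .stay)
  | _, _, _, .misdigit => (.reject, .stay)
  | .rewind, .leftEnd, _, .advance => (.sweep true, .stay)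
  | .rewind, _, _, .advance => (.rewind, .left)
  | .sweep true, .rightEnd, _, .advance => (.accept, .stay)
  | .sweep false, .rightEnd, _, .advance => (.rewind, .stay)
  | .sweep e, σ, m, .advance => (.sweep (e && m == bitOf σ), .right)

/-- The verifier. Its amplitudes depend on the real number `α`, which encodes the language. -/
noncomputable def verifier (α : Set.Icc (0 : ℝ) (1 / 4)) : Verifier Bool 4 where
  State := Phase
  Msg := Bool
  Outcome := Coin
  start := .sweep true
  qstart := 0
  accepting := {.accept}
  rejecting := {.reject}
  disjoint_verdicts := by simp
  op := coinOp α
  complete q σ m := by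
    rw [sum_coin, ← completion_spec α q σ m, Fin.sum_univ_three, ← sum_resetOp (completion α q σ m)]
    rfl
  next := nextPhase
  next_leftEnd q m i := by
    rcases q with (_ | _) | _ | _ | _ <;> cases i <;> simp [nextPhase]
  next_rightEnd q m i := by
    rcases q with (_ | _) | _ | _ | _ <;> cases i <;> simp [nextPhase]

/-! ### One step of the verifier -/

/-- The sum over all outcomes of the value of `φ` at the next configuration. -/
noncomputable def stepSum (α : Set.Icc (0 : ℝ) (1 / 4)) (w : List Bool)
    (φ : Phase → ℕ → (Fin 4 → ℂ) → ℝ) (q : Phase) (p : ℕ) (ψ : Fin 4 → ℂ) (m : Bool) : ℝ :=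
  ∑ i, φ (nextPhase q (scan w p) m i).1 ((nextPhase q (scan w p) m i).2.move p)
    (coinOp α q (scan w p) m i *ᵥ ψ)

theorem mass_single {j : ℕ} (i : Fin j) (z : ℂ) : mass (Pi.single i z) = ‖z‖ ^ 2 := by
  rw [mass, Finset.sum_eq_single i (fun b _ hb => by simp [hb]) (by simp), Pi.single_eq_same]

section Step

variable (α : Set.Icc (0 : ℝ) (1 / 4)) (w : List Bool) (φ : Phase → ℕ → (Fin 4 → ℂ) → ℝ)

/-- The restarts carry all the mass that is not accounted for by the other outcomes. -/
theorem sum_restart {p : ℕ} {ρ : ℝ} (hρ : ∀ z, φ .rewind p (Pi.single 0 z) = ρ * ‖z‖ ^ 2)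
    (q : Phase) (σ : TapeSym Bool) (m : Bool) (ψ : Fin 4 → ℂ) :
    ∑ k, φ .rewind p (coinOp α q σ m (.restart k) *ᵥ ψ)
      = ρ * (mass ψ - (mass (core α q σ m 0 *ᵥ ψ) + mass (core α q σ m 1 *ᵥ ψ)
          + mass (core α q σ m 2 *ᵥ ψ))) := by
  have htot := sum_mass_mulVec _ ψ ((verifier α).complete q σ m)
  have h2 : ∑ i, mass (coinOp α q σ m i *ᵥ ψ) = mass ψ := htot
  rw [sum_coin] at h2
  rw [← h2]
  simp only [coinOp, resetOp_mulVec, hρ, mass_single, ← Finset.mul_sum]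
  ring

variable {φ} {r ρ : ℝ} {p : ℕ} (hr : ∀ ψ, φ .reject p ψ = r * mass ψ)
  (hρ : ∀ z, φ .rewind p (Pi.single 0 z) = ρ * ‖z‖ ^ 2)

theorem stepSum_rewind_zero (hr : ∀ ψ, φ .reject 0 ψ = r * mass ψ)
    (hρ : ∀ z, φ .rewind 0 (Pi.single 0 z) = ρ * ‖z‖ ^ 2) (ψ : Fin 4 → ℂ) (m : Bool) :
    stepSum α w φ .rewind 0 ψ m = φ (.sweep true) 0 ψ := by
  have h := sum_restart α φ hρ .rewind .leftEnd m ψ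
  rw [stepSum, sum_coin]
  simp only [scan, nextPhase, Dir.move, h, hr]
  simp [coinOp, core, mass_zero]

theorem stepSum_rewind_succ (hr : ∀ ψ, φ .reject (p + 1) ψ = r * mass ψ)
    (hρ : ∀ z, φ .rewind (p + 1) (Pi.single 0 z) = ρ * ‖z‖ ^ 2) (ψ : Fin 4 → ℂ) (m : Bool) :
    stepSum α w φ .rewind (p + 1) ψ m = φ .rewind p ψ := by
  have hs := scan_ne_leftEnd (w := w) p.succ_ne_zero
  have h := sum_restart α φ hρ .rewind (scan w (p + 1)) m ψ
  rw [stepSum, sum_coin]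
  generalize scan w (p + 1) = σ at *
  cases σ
  · exact absurd rfl hs
  all_goals
    simp only [nextPhase, Dir.move, h, hr]
    simp [coinOp, core, mass_zero]

include hr hρ

theorem stepSum_sweep (hp : p ≤ w.length) (e : Bool) (ψ : Fin 4 → ℂ) (m : Bool) :
    stepSum α w φ (.sweep e) p ψ m
      = φ (.sweep (e && m == bitOf (scan w p))) (p + 1) (readOp m *ᵥ ψ)
        + ρ * (mass ψ - mass (readOp m *ᵥ ψ)) := by
  have hs := scan_ne_rightEnd hp
  have h := sum_restart α φ hρ (.sweep e) (scan w p) m ψ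
  rw [stepSum, sum_coin]
  generalize scan w p = σ at *
  cases σ <;> cases e <;> first
    | exact absurd rfl hs
    | simp only [nextPhase, Dir.move, h, hr]
      simp [coinOp, core, mass_zero]

theorem stepSum_shift (hp : p = w.length + 1) (ψ : Fin 4 → ℂ) (m : Bool) :
    stepSum α w φ (.sweep false) p ψ m
      = φ .rewind p (shiftOp α m *ᵥ ψ) + r * mass (miscountOp *ᵥ ψ)
        + ρ * (mass ψ - mass (shiftOp α m *ᵥ ψ) - mass (miscountOp *ᵥ ψ)) := by
  subst hp
  have h := sum_restart α φ hρ (.sweep false) .rightEnd m ψ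
  rw [stepSum, sum_coin, scan_length_add_one]
  simp only [nextPhase, Dir.move, h, hr]
  simp [coinOp, core, mass_zero]
  left
  ring

theorem stepSum_verdict (hp : p = w.length + 1) (ψ : Fin 4 → ℂ) (m : Bool) :
    stepSum α w φ (.sweep true) p ψ m
      = φ .accept p (acceptOp *ᵥ ψ)
        + r * (mass (miscountOp *ᵥ ψ) + mass (misdigitOp α *ᵥ ψ))
        + ρ * (mass ψ - mass (acceptOp *ᵥ ψ) - mass (miscountOp *ᵥ ψ)
          - mass (misdigitOp α *ᵥ ψ)) := by
  subst hp
  have h := sum_restart α φ hρ (.sweep true) .rightEnd m ψ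
  rw [stepSum, sum_coin, scan_length_add_one]
  simp only [nextPhase, Dir.move, h, hr]
  simp [coinOp, core]
  ring

end Step

/-! ### Rounds without a counter fault -/

/-- The configuration belongs to a round in which `s` complete counter values `1, …, s`, all below
`code w`, have been sent; the bits `v` of the next value are being read; and the register holds, up
to the factor `z`, the numbers `1`, `x - α`, `s` and `v`. A rewinding configuration belongs to such
a round with `v = 0`. -/
def Tracks (α : ℝ) (w : List Bool) (s v : ℕ) (x : ℝ) (z : ℂ) (q : Phase) (ψ : Fin 4 → ℂ)
    (p : ℕ) : Prop :=
  s < code w ∧ ψ = z • ![1, ((x - α : ℝ) : ℂ), (s : ℂ), (v : ℂ)] ∧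
    match q with
    | .rewind => v = 0
    | .sweep e => e = true ↔ v = prefixCode w p
    | _ => False

section Tracks

variable {α : ℝ} {w : List Bool} {s v : ℕ} {x : ℝ} {z : ℂ} {ψ : Fin 4 → ℂ} {p : ℕ}

theorem Tracks.reg_zero {q : Phase} (h : Tracks α w s v x z q ψ p) : ψ 0 = z := by
  simp [h.2.1]

theorem Tracks.reg_two {q : Phase} (h : Tracks α w s v x z q ψ p) : ψ 2 = z * s := by
  simp [h.2.1]

theorem tracks_single (p : ℕ) (z : ℂ) :
    Tracks α w 0 0 α z .rewind (Pi.single 0 z) p := by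
  refine ⟨code_pos w, ?_, rfl⟩
  ext x
  fin_cases x <;> simp

theorem Tracks.rewind (h : Tracks α w s v x z .rewind ψ p) (p' : ℕ) :
    Tracks α w s v x z .rewind ψ p' := h

theorem Tracks.start (h : Tracks α w s v x z .rewind ψ 0) :
    Tracks α w s v x z (.sweep true) ψ 0 :=
  ⟨h.1, h.2.1, by simpa [prefixCode] using h.2.2⟩

theorem Tracks.read {e : Bool} (h : Tracks α w s v x z (.sweep e) ψ p) (m : Bool) :
    Tracks α w s (2 * v + m.toNat) x (1 / 16 * z) (.sweep (e && m == bitOf (scan w p)))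
      (readOp m *ᵥ ψ) (p + 1) := by
  obtain ⟨h1, h2, h3⟩ := h
  refine ⟨h1, ?_, ?_⟩
  · rw [readOp_mulVec, mul_smul, h2]
    congr 1
    ext x
    fin_cases x <;> simp
    ring
  · change e = true ↔ v = prefixCode w p at h3
    change (e && m == bitOf (scan w p)) = true ↔ 2 * v + m.toNat = prefixCode w (p + 1)
    rw [Bool.and_eq_true, h3, prefixCode, beq_iff_eq]
    cases m <;> cases bitOf (scan w p) <;> simp <;> omega

theorem Tracks.shift (h : Tracks α w s (s + 1) x z (.sweep false) ψ (w.length + 1)) (d : Bool)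
    (p' : ℕ) :
    Tracks α w (s + 1) 0 (5 * x - d.toNat) (1 / 16 * z) .rewind (shiftOp α d *ᵥ ψ) p' := by
  obtain ⟨h1, h2, h3⟩ := h
  refine ⟨?_, ?_, rfl⟩
  · have : s + 1 ≠ code w := by simpa using! h3
    omega
  · rw [shiftOp_mulVec, mul_smul, h2]
    congr 1
    ext x
    fin_cases x <;> simp
    ring

theorem Tracks.mass_miscountOp {q : Phase} (h : Tracks α w s v x z q ψ p) :
    mass (miscountOp *ᵥ ψ) = ‖z‖ ^ 2 / 64 * ((v : ℝ) - s - 1) ^ 2 := by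
  have : z * (v : ℂ) - z * s - z = z * ((v - s - 1 : ℝ) : ℂ) := by push_cast; ring
  rw [miscountOp_mulVec, mass_smul, mass_vec, h.2.1]
  simp [this, -Complex.ofReal_sub, mul_pow]
  ring

theorem Tracks.mass_misdigitOp {q : Phase} (h : Tracks α w s v x z q ψ p) :
    mass (misdigitOp α *ᵥ ψ) = ‖z‖ ^ 2 / 64 * (5 * x - 1) ^ 2 := by
  have : ((5 * α - 1 : ℝ) : ℂ) * z + 5 * (z * ((x - α : ℝ) : ℂ)) = z * ((5 * x - 1 : ℝ) : ℂ) := by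
    push_cast; ring
  rw [misdigitOp_mulVec, mass_smul, mass_vec, h.2.1]
  simp [this, -Complex.ofReal_sub, mul_pow]
  ring

theorem mass_acceptOp (ψ : Fin 4 → ℂ) : mass (acceptOp *ᵥ ψ) = ‖ψ 0‖ ^ 2 / 256 := by
  rw [acceptOp_mulVec, mass_smul, mass_vec]
  norm_num
  ring

/-- Counter values are integers, so a wrong one differs from the right one by at least one. -/
theorem Tracks.le_mass_miscountOp {q : Phase} (h : Tracks α w s v x z q ψ p) (hv : v ≠ s + 1) :
    ‖z‖ ^ 2 / 64 ≤ mass (miscountOp *ᵥ ψ) := by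
  rw [h.mass_miscountOp]
  have h1 : (1 : ℝ) ≤ ((v : ℝ) - s - 1) ^ 2 := by
    have h2 : ((v : ℤ) - s - 1) ≠ 0 := by omega
    have h3 : (1 : ℤ) ≤ ((v : ℤ) - s - 1) ^ 2 := by
      have := sq_pos_of_ne_zero h2
      omega
    exact_mod_cast h3
  nlinarith [sq_nonneg ‖z‖]

theorem readOp_reg_zero (m : Bool) (ψ : Fin 4 → ℂ) :
    ‖(readOp m *ᵥ ψ) 0‖ ^ 2 = ‖ψ 0‖ ^ 2 / 256 := by
  rw [readOp_mulVec]
  simp [mul_pow]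
  ring

theorem shiftOp_reg_zero (α : ℝ) (d : Bool) (ψ : Fin 4 → ℂ) :
    ‖(shiftOp α d *ᵥ ψ) 0‖ ^ 2 = ‖ψ 0‖ ^ 2 / 256 := by
  rw [shiftOp_mulVec]
  simp [mul_pow]
  ring

theorem norm_reg_zero_sq_le (ψ : Fin 4 → ℂ) : ‖ψ 0‖ ^ 2 ≤ mass ψ := by
  rw [mass_four]
  nlinarith [sq_nonneg ‖ψ 1‖, sq_nonneg ‖ψ 2‖, sq_nonneg ‖ψ 3‖]

end Tracks

/-! ### Soundness -/

section Soundness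

/-- A round without a counter fault in which every digit so far was correct, or the remainder has
left the range of correct remainders for good. -/
def Sound (d : ℕ → Bool) (w : List Bool) (q : Phase) (p : ℕ) (ψ : Fin 4 → ℂ) : Prop :=
  ∃ s v x z, Tracks (tail d 0) w s v x z q ψ p ∧ (x = tail d s ∨ 3 / 4 ≤ |x|)

open Classical in
/-- The potential that bounds the acceptance probability of a nonmember: one third of the mass,
and after a fault whatever can still be accepted in this round on top of it. -/
noncomputable def soundPotential (d : ℕ → Bool) (w : List Bool) (q : Phase) (p : ℕ)
    (ψ : Fin 4 → ℂ) : ℝ :=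
  match q with
  | .accept => mass ψ
  | .reject => 0
  | _ => mass ψ / 3 + if Sound d w q p ψ then 0 else 2 / 3 * ‖ψ 0‖ ^ 2

variable {d : ℕ → Bool} {w : List Bool} {q : Phase} {p : ℕ} {ψ : Fin 4 → ℂ}

theorem soundPotential_nonneg (q : Phase) : 0 ≤ soundPotential d w q p ψ := by
  have := mass_nonneg ψ
  have : 0 ≤ ‖ψ 0‖ ^ 2 := by positivity
  cases q <;> simp only [soundPotential] <;> (try split_ifs) <;> linarith

theorem soundPotential_of_sound (h : Sound d w q p ψ) :
    soundPotential d w q p ψ = mass ψ / 3 := by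
  obtain ⟨s, v, x, z, ht, -⟩ := id h
  cases q
  · simp [soundPotential, h]
  · simp [soundPotential, h]
  · exact ht.2.2.elim
  · exact ht.2.2.elim

theorem soundPotential_sweep_le (e : Bool) :
    soundPotential d w (.sweep e) p ψ ≤ mass ψ / 3 + 2 / 3 * ‖ψ 0‖ ^ 2 := by
  have : 0 ≤ ‖ψ 0‖ ^ 2 := by positivity
  simp only [soundPotential]
  split_ifs <;> linarith

theorem soundPotential_rewind_le :
    soundPotential d w .rewind p ψ ≤ mass ψ / 3 + 2 / 3 * ‖ψ 0‖ ^ 2 := by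
  have : 0 ≤ ‖ψ 0‖ ^ 2 := by positivity
  simp only [soundPotential]
  split_ifs <;> linarith

theorem soundPotential_sweep_of_not {e : Bool} (h : ¬ Sound d w (.sweep e) p ψ) :
    soundPotential d w (.sweep e) p ψ = mass ψ / 3 + 2 / 3 * ‖ψ 0‖ ^ 2 := by
  simp [soundPotential, h]

theorem soundPotential_rewind_of_not (h : ¬ Sound d w .rewind p ψ) :
    soundPotential d w .rewind p ψ = mass ψ / 3 + 2 / 3 * ‖ψ 0‖ ^ 2 := by
  simp [soundPotential, h]

/-- A wrong digit moves the remainder out of the range of correct remainders, and from there it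
never returns. -/
theorem remainder_step {s : ℕ} {x : ℝ} (b : Bool) (h : x = tail d s ∨ 3 / 4 ≤ |x|) :
    (5 * x - b.toNat = tail d (s + 1) ∧ b = d (s + 1)) ∨ 3 / 4 ≤ |5 * x - b.toNat| := by
  rcases h with h | h
  · have h1 := five_mul_tail d s
    have h2 := tail_nonneg d (s + 1)
    have h3 := tail_le d (s + 1)
    rw [← h] at h1
    rw [h1]
    cases b <;> cases d (s + 1)
    · left; simp
    · right
      rw [le_abs]
      left
      simp only [Bool.toNat_true, Bool.toNat_false, Nat.cast_one, Nat.cast_zero]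
      linarith
    · right
      rw [le_abs]
      right
      simp only [Bool.toNat_true, Bool.toNat_false, Nat.cast_one, Nat.cast_zero]
      linarith
    · left; simp
  · right
    have hb := toNat_cast_nonneg_le b
    rw [le_abs] at h ⊢
    rcases h with h | h
    · left; linarith
    · right; linarith

/-- The number whose base-`5` digits encode `d`, as a parameter of the verifier. -/
noncomputable def encoding (d : ℕ → Bool) : Set.Icc (0 : ℝ) (1 / 4) :=
  ⟨tail d 0, tail_nonneg d 0, tail_le d 0⟩

theorem sound_single (p : ℕ) (z : ℂ) : Sound d w .rewind p (Pi.single 0 z) :=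
  ⟨0, 0, tail d 0, z, tracks_single p z, Or.inl rfl⟩

theorem stepSum_soundPotential_le (hd : d (code w) = false) (hp : p ≤ w.length + 1)
    (hq : q ≠ .accept ∧ q ≠ .reject) (m : Bool) :
    stepSum (encoding d) w (soundPotential d w) q p ψ m ≤ soundPotential d w q p ψ := by
  have hr : ∀ p ψ, soundPotential d w .reject p ψ = 0 * mass ψ := fun p ψ => by
    simp [soundPotential]
  have hρ : ∀ p z, soundPotential d w .rewind p (Pi.single 0 z) = 1 / 3 * ‖z‖ ^ 2 := fun p z => by
    rw [soundPotential_of_sound (sound_single p z), mass_single]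
    ring
  have hz : 0 ≤ ‖ψ 0‖ ^ 2 := by positivity
  rcases q with e | _ | _ | _
  · rcases Nat.le_succ_iff.1 hp with hp | hp
    · rw [stepSum_sweep _ w (hr p) (hρ p) hp]
      by_cases h : Sound d w (.sweep e) p ψ
      · rw [soundPotential_of_sound h, soundPotential_of_sound]
        · linarith
        · obtain ⟨s, v, x, z, ht, hx⟩ := h
          exact ⟨s, _, x, _, ht.read m, hx⟩
      · have h1 := soundPotential_sweep_le (d := d) (w := w) (p := p + 1)
          (ψ := readOp m *ᵥ ψ) (e && m == bitOf (scan w p))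
        rw [readOp_reg_zero] at h1
        rw [soundPotential_sweep_of_not h]
        linarith
    · have hp : p = w.length + 1 := hp
      have hmis := mass_nonneg (miscountOp *ᵥ ψ)
      cases e
      · rw [stepSum_shift _ w (hr p) (hρ p) hp]
        have h1 := soundPotential_rewind_le (d := d) (w := w) (p := p)
          (ψ := shiftOp (encoding d) m *ᵥ ψ)
        rw [shiftOp_reg_zero] at h1
        by_cases h : Sound d w (.sweep false) p ψ
        · rw [soundPotential_of_sound h]
          obtain ⟨s, v, x, z, ht, hx⟩ := h
          by_cases hv : v = s + 1
          · subst hv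
            rw [soundPotential_of_sound]
            · linarith
            · subst hp
              exact ⟨s + 1, 0, _, _, ht.shift m _,
                (remainder_step m hx).imp_left And.left⟩
          · have h2 := ht.le_mass_miscountOp hv
            rw [ht.reg_zero] at h1
            linarith
        · rw [soundPotential_sweep_of_not h]
          linarith
      · rw [stepSum_verdict _ w (hr p) (hρ p) hp]
        have hdig := mass_nonneg (misdigitOp (encoding d) *ᵥ ψ)
        have hacc := mass_acceptOp ψ
        simp only [soundPotential.eq_1]
        by_cases h : Sound d w (.sweep true) p ψ
        · rw [soundPotential_of_sound h]
          obtain ⟨s, v, x, z, ht, hx⟩ := h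
          rw [ht.reg_zero] at hacc
          by_cases hv : v = s + 1
          · have hs : s + 1 = code w := by
              rw [← hv, code, ← hp]
              exact ht.2.2.1 rfl
            have h3 : 3 / 4 ≤ |5 * x - 1| := by
              rcases remainder_step true hx with h4 | h4
              · rw [hs, hd] at h4
                exact absurd h4.2 (by simp)
              · simpa using h4
            have h5 : mass (misdigitOp (encoding d) *ᵥ ψ) = _ := ht.mass_misdigitOp
            have h6 : (9 : ℝ) / 16 ≤ (5 * x - 1) ^ 2 := by
              rw [← sq_abs]
              nlinarith
            have h7 : ‖z‖ ^ 2 / 64 * (9 / 16) ≤ ‖z‖ ^ 2 / 64 * (5 * x - 1) ^ 2 := by gcongr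
            rw [← h5] at h7
            rw [ht.reg_zero] at hz
            linarith
          · have h2 := ht.le_mass_miscountOp hv
            rw [ht.reg_zero] at hz
            linarith
        · rw [soundPotential_sweep_of_not h]
          linarith
  · cases p with
    | zero =>
      rw [stepSum_rewind_zero _ w (hr _) (hρ _)]
      by_cases h : Sound d w .rewind 0 ψ
      · rw [soundPotential_of_sound h, soundPotential_of_sound]
        obtain ⟨s, v, x, z, ht, hx⟩ := h
        exact ⟨s, v, x, z, ht.start, hx⟩
      · rw [soundPotential_rewind_of_not h]
        exact soundPotential_sweep_le _
    | succ p =>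
      rw [stepSum_rewind_succ _ w (hr _) (hρ _)]
      by_cases h : Sound d w .rewind (p + 1) ψ
      · rw [soundPotential_of_sound h, soundPotential_of_sound]
        obtain ⟨s, v, x, z, ht, hx⟩ := h
        exact ⟨s, v, x, z, ht.rewind p, hx⟩
      · rw [soundPotential_rewind_of_not h]
        exact soundPotential_rewind_le
  · exact absurd rfl hq.1
  · exact absurd rfl hq.2

end Soundness

/-! ### Completeness -/

section Completeness

/-- A halting configuration, or one in a round in which all digits so far were correct and the
bits sent in the current sweep are the leading bits of the next counter value. -/
def Honest (d : ℕ → Bool) (w : List Bool) (q : Phase) (p : ℕ) (ψ : Fin 4 → ℂ) : Prop :=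
  match q with
  | .rewind => ∃ s z, Tracks (tail d 0) w s 0 (tail d s) z .rewind ψ p
  | .sweep e => ∃ s z,
      Tracks (tail d 0) w s ((s + 1) / 2 ^ (w.length + 1 - p)) (tail d s) z (.sweep e) ψ p
  | _ => True

/-- The potential that bounds the rejection probability of a member under the honest prover. -/
noncomputable def honestPotential (q : Phase) (_p : ℕ) (ψ : Fin 4 → ℂ) : ℝ :=
  match q with
  | .accept => 0
  | .reject => mass ψ
  | _ => mass ψ / 3

variable {d : ℕ → Bool} {w : List Bool} {q : Phase} {p : ℕ} {ψ : Fin 4 → ℂ}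

theorem honestPotential_nonneg (q : Phase) : 0 ≤ honestPotential q p ψ := by
  have := mass_nonneg ψ
  cases q <;> simp only [honestPotential] <;> linarith

theorem honest_single (p : ℕ) (z : ℂ) : Honest d w .rewind p (Pi.single 0 z) :=
  ⟨0, z, tracks_single p z⟩

/-- Appending the next binary digit of `k` to its leading digits. -/
theorem div_two_pow_succ (k j : ℕ) :
    2 * (k / 2 ^ (j + 1)) + (decide (k / 2 ^ j % 2 = 1)).toNat = k / 2 ^ j := by
  rw [pow_succ, ← Nat.div_div_eq_div_mul]
  rcases Nat.mod_two_eq_zero_or_one (k / 2 ^ j) with h | h <;> simp [h] <;> omega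

theorem honest_restart (q : Phase) (hq : q ≠ .accept ∧ q ≠ .reject) (k : Fin 4) (m : Bool)
    (σ : TapeSym Bool) : Honest d w (nextPhase q σ m (.restart k)).1
      ((nextPhase q σ m (.restart k)).2.move p) (coinOp (encoding d) q σ m (.restart k) *ᵥ ψ) := by
  have h : nextPhase q σ m (.restart k) = (.rewind, .stay) := by
    rcases q with _ | _ | _ | _
    · rfl
    · rfl
    · exact absurd rfl hq.1
    · exact absurd rfl hq.2
  rw [h, coinOp, resetOp_mulVec]
  exact honest_single _ _

theorem honest_fault (q : Phase) (hq : q ≠ .accept ∧ q ≠ .reject) {i : Coin}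
    (hi : i = .miscount ∨ i = .misdigit) (m : Bool) (σ : TapeSym Bool) (p : ℕ)
    (ψ : Fin 4 → ℂ) : Honest d w (nextPhase q σ m i).1 p ψ := by
  have h : nextPhase q σ m i = (.reject, .stay) := by
    rcases q with _ | _ | _ | _
    · rcases hi with rfl | rfl <;> rfl
    · rcases hi with rfl | rfl <;> rfl
    · exact absurd rfl hq.1
    · exact absurd rfl hq.2
  rw [h]
  trivial

theorem honest_step (hq : q ≠ .accept ∧ q ≠ .reject) {m : Bool}
    (hadv : Honest d w (nextPhase q (scan w p) m .advance).1
      ((nextPhase q (scan w p) m .advance).2.move p)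
      (coinOp (encoding d) q (scan w p) m .advance *ᵥ ψ)) (i : Coin) :
    Honest d w (nextPhase q (scan w p) m i).1 ((nextPhase q (scan w p) m i).2.move p)
      (coinOp (encoding d) q (scan w p) m i *ᵥ ψ) := by
  cases i with
  | advance => exact hadv
  | miscount => exact honest_fault q hq (Or.inl rfl) _ _ _ _
  | misdigit => exact honest_fault q hq (Or.inr rfl) _ _ _ _
  | restart k => exact honest_restart q hq k _ _

/-- The honest prover always has a symbol that keeps the round free of faults. -/
theorem exists_honest_msg (hd : d (code w) = true) (hp : p ≤ w.length + 1)
    (hq : q ≠ .accept ∧ q ≠ .reject) (h : Honest d w q p ψ) :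
    ∃ m, stepSum (encoding d) w honestPotential q p ψ m ≤ honestPotential q p ψ ∧
      ∀ i, Honest d w (nextPhase q (scan w p) m i).1 ((nextPhase q (scan w p) m i).2.move p)
        (coinOp (encoding d) q (scan w p) m i *ᵥ ψ) := by
  have hr : ∀ p ψ, honestPotential .reject p ψ = 1 * mass ψ := fun p ψ => by
    simp [honestPotential]
  have hρ : ∀ p z, honestPotential .rewind p (Pi.single 0 z) = 1 / 3 * ‖z‖ ^ 2 := fun p z => by
    simp only [honestPotential, mass_single]
    ring
  rcases q with e | _ | _ | _
  · obtain ⟨s, z, ht⟩ := h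
    rcases Nat.le_succ_iff.1 hp with hp | hp
    · refine ⟨decide ((s + 1) / 2 ^ (w.length + 1 - (p + 1)) % 2 = 1), ?_,
        honest_step hq ?_⟩
      · rw [stepSum_sweep _ w (hr p) (hρ p) hp]
        simp only [honestPotential]
        linarith
      · have hs := scan_ne_rightEnd hp
        have h1 := ht.read (decide ((s + 1) / 2 ^ (w.length + 1 - (p + 1)) % 2 = 1))
        rw [show w.length + 1 - p = w.length + 1 - (p + 1) + 1 by omega, div_two_pow_succ] at h1
        generalize scan w p = σ at *
        cases σ <;> cases e <;> first
          | exact absurd rfl hs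
          | exact ⟨s, _, h1⟩
    · have hp : p = w.length + 1 := hp
      subst hp
      simp only [Nat.sub_self, pow_zero, Nat.div_one] at ht
      have hmis : mass (miscountOp *ᵥ ψ) = 0 := by
        rw [ht.mass_miscountOp]
        simp
      cases e
      · refine ⟨d (s + 1), ?_, honest_step hq ?_⟩
        · rw [stepSum_shift _ w (hr _) (hρ _) rfl, hmis]
          simp only [honestPotential]
          linarith
        · have h1 := ht.shift (d (s + 1)) (w.length + 1)
          rw [five_mul_tail, add_sub_cancel_left] at h1
          rw [scan_length_add_one]
          exact ⟨s + 1, _, h1⟩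
      · refine ⟨true, ?_, honest_step hq ?_⟩
        · rw [stepSum_verdict _ w (hr _) (hρ _) rfl, hmis]
          have hs : s + 1 = code w := ht.2.2.1 rfl
          have h1 := five_mul_tail d s
          rw [hs, hd] at h1
          simp only [Bool.toNat_true, Nat.cast_one] at h1
          have h2 : mass (misdigitOp (encoding d) *ᵥ ψ) = _ := ht.mass_misdigitOp
          rw [show 5 * tail d s - 1 = tail d (code w) by linarith] at h2
          have h3 : tail d (code w) ^ 2 ≤ (1 / 4) ^ 2 :=
            pow_le_pow_left₀ (tail_nonneg _ _) (tail_le _ _) 2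
          have h4 : ‖z‖ ^ 2 / 64 * tail d (code w) ^ 2 ≤ ‖z‖ ^ 2 / 64 * (1 / 4) ^ 2 := by gcongr
          rw [← h2] at h4
          have h5 := mass_acceptOp ψ
          rw [ht.reg_zero] at h5
          have h6 : 0 ≤ ‖z‖ ^ 2 := by positivity
          simp only [honestPotential]
          linarith
        · rw [scan_length_add_one]
          trivial
  · refine ⟨true, ?_, honest_step hq ?_⟩
    · cases p with
      | zero => exact (stepSum_rewind_zero _ w (hr _) (hρ _) ψ _).le
      | succ p => exact (stepSum_rewind_succ _ w (hr _) (hρ _) ψ _).le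
    · obtain ⟨s, z, ht⟩ := h
      cases p with
      | zero =>
        have h0 : (s + 1) / 2 ^ (w.length + 1 - 0) = 0 :=
          Nat.div_eq_of_lt (lt_of_le_of_lt ht.1 (prefixCode_lt w _))
        simp only [scan, nextPhase, Dir.move, coinOp, core, Matrix.cons_val_zero,
          Matrix.one_mulVec]
        refine ⟨s, z, ?_⟩
        rw [h0]
        exact ht.start
      | succ p =>
        have hs := scan_ne_leftEnd (w := w) p.succ_ne_zero
        generalize scan w (p + 1) = σ at *
        cases σ
        · exact absurd rfl hs
        all_goals
          simp only [nextPhase, Dir.move, coinOp, core, Matrix.cons_val_zero,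
            Matrix.one_mulVec]
          exact ⟨s, z, ht.rewind p⟩
  · exact absurd rfl hq.1
  · exact absurd rfl hq.2

end Completeness

/-! ### Expected runtime -/

section Runtime

/-- The number of squares read in the current sweep, when the head is on square `p`. -/
def Phase.swept : Phase → ℕ → ℕ
  | .sweep _, p => p
  | _, _ => 0

theorem Phase.swept_le (q : Phase) (p : ℕ) : q.swept p ≤ p := by
  cases q <;> simp [swept]

/-- The number of sweeping steps made in the current round, as read off from the register. -/
noncomputable def elapsed (w : List Bool) (q : Phase) (p : ℕ) (ψ : Fin 4 → ℂ) : ℕ :=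
  ⌊(ψ 2 / ψ 0).re⌋₊ * (w.length + 2) + q.swept p

open Classical in
/-- The advantage over an arbitrary configuration that a round without a counter fault has: it is
certain to halt with some probability. The factor `256 ^ elapsed` balances the decay of `‖ψ 0‖ ^ 2`
in each sweeping step. The constant `2 * (n + 4)` pays for a sweeping step and for the rewinding
after a restart, as a sweeping step leads to a restart or a verdict with probability at least
one half. -/
noncomputable def credit (α : ℝ) (w : List Bool) (q : Phase) (p : ℕ) (ψ : Fin 4 → ℂ) : ℝ :=
  if ∃ s v x z, Tracks α w s v x z q ψ p then
    2 * (w.length + 4) * ‖ψ 0‖ ^ 2 * 256 ^ elapsed w q p ψ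
  else 0

/-- A bound for the expected runtime of a whole computation. -/
noncomputable def runtimeBound (w : List Bool) : ℝ :=
  2 * (w.length + 4) * 256 ^ (code w * (w.length + 2))

/-- The potential that bounds the expected number of remaining steps. -/
noncomputable def runtimePotential (α : ℝ) (w : List Bool) (q : Phase) (p : ℕ)
    (ψ : Fin 4 → ℂ) : ℝ :=
  match q with
  | .rewind => (runtimeBound w + 2 * (w.length + 4) + p + 1) * mass ψ - credit α w .rewind p ψ
  | .sweep e => (runtimeBound w + 2 * (w.length + 4)) * mass ψ - credit α w (.sweep e) p ψ
  | _ => 0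

variable {α : ℝ} {w : List Bool} {q : Phase} {p : ℕ} {ψ : Fin 4 → ℂ}

theorem runtimeBound_nonneg (w : List Bool) : 0 ≤ runtimeBound w := by
  unfold runtimeBound
  positivity

theorem credit_nonneg : 0 ≤ credit α w q p ψ := by
  unfold credit
  split_ifs <;> positivity

theorem Tracks.credit_eq {s v : ℕ} {x : ℝ} {z : ℂ} (h : Tracks α w s v x z q ψ p) :
    credit α w q p ψ = 2 * (w.length + 4) * ‖z‖ ^ 2
      * 256 ^ (s * (w.length + 2) + q.swept p) := by
  rw [credit, if_pos ⟨s, v, x, z, h⟩, h.reg_zero]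
  by_cases hz : z = 0
  -- the register is zero, so the quotient in `elapsed` is a junk value, but its weight is zero
  · simp only [hz, norm_zero, ne_eq, OfNat.ofNat_ne_zero, not_false_eq_true, zero_pow, mul_zero,
      zero_mul]
  · rw [elapsed, h.reg_zero, h.reg_two, mul_div_cancel_left₀ _ hz, Complex.natCast_re,
      Nat.floor_natCast]

/-- A round without a counter fault takes at most `code w` sweeps, so the credit never outgrows the
runtime saved by the chance to halt in the next step. -/
theorem Tracks.credit_le {s v : ℕ} {x : ℝ} {z : ℂ} (h : Tracks α w s v x z q ψ p)
    (hp : p ≤ w.length + 1) : 256 * credit α w q p ψ ≤ runtimeBound w * ‖z‖ ^ 2 := by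
  rw [h.credit_eq, runtimeBound]
  have hle : s * (w.length + 2) + q.swept p + 1
      ≤ code w * (w.length + 2) := by
    have h1 : (s + 1) * (w.length + 2) ≤ code w * (w.length + 2) :=
      Nat.mul_le_mul_right _ h.1
    rw [add_mul] at h1
    have h2 := q.swept_le p
    omega
  have h2 : (256 : ℝ) ^ (s * (w.length + 2) + q.swept p + 1)
      ≤ 256 ^ (code w * (w.length + 2)) := pow_le_pow_right₀ (by norm_num) hle
  rw [pow_succ] at h2
  have h3 : (0 : ℝ) ≤ 2 * (w.length + 4) * ‖z‖ ^ 2 := by positivity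
  nlinarith [mul_le_mul_of_nonneg_left h2 h3]

theorem credit_le (hp : p ≤ w.length + 1) : credit α w q p ψ ≤ runtimeBound w * mass ψ := by
  by_cases h : ∃ s v x z, Tracks α w s v x z q ψ p
  · obtain ⟨s, v, x, z, h⟩ := h
    have h1 := h.credit_le hp
    have h2 := norm_reg_zero_sq_le ψ
    rw [h.reg_zero] at h2
    have h3 := mul_le_mul_of_nonneg_left h2 (runtimeBound_nonneg w)
    have h4 := credit_nonneg (α := α) (w := w) (q := q) (p := p) (ψ := ψ)
    linarith
  · rw [credit, if_neg h]
    exact mul_nonneg (runtimeBound_nonneg w) (mass_nonneg ψ)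

theorem runtimePotential_nonneg (hp : p ≤ w.length + 1) (q : Phase) :
    0 ≤ runtimePotential α w q p ψ := by
  have h0 := mass_nonneg ψ
  have h1 := credit_le (α := α) (q := q) (ψ := ψ) hp
  cases q <;> simp only [runtimePotential]
  · have : 0 ≤ 2 * ((w.length : ℝ) + 4) * mass ψ := by positivity
    linarith
  · have : 0 ≤ (2 * ((w.length : ℝ) + 4) + p + 1) * mass ψ := by positivity
    linarith
  · exact le_rfl
  · exact le_rfl

theorem stepSum_runtimePotential_le (α : Set.Icc (0 : ℝ) (1 / 4)) (hp : p ≤ w.length + 1)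
    (hq : q ≠ .accept ∧ q ≠ .reject) (m : Bool) :
    mass ψ + stepSum α w (runtimePotential α w) q p ψ m ≤ runtimePotential α w q p ψ := by
  have hr : ∀ p ψ, runtimePotential α w .reject p ψ = 0 * mass ψ := fun p ψ => by
    simp [runtimePotential]
  have hρ : ∀ p z, runtimePotential α w .rewind p (Pi.single 0 z)
      = (runtimeBound w + p + 1) * ‖z‖ ^ 2 := fun p z => by
    rw [runtimePotential, (tracks_single p z).credit_eq, mass_single]
    simp only [Phase.swept, zero_mul, add_zero, pow_zero]
    ring
  have hT := runtimeBound_nonneg w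
  have hM := mass_nonneg ψ
  have hpM : (p : ℝ) * mass ψ ≤ (w.length + 1) * mass ψ := by
    have : (p : ℝ) ≤ w.length + 1 := by exact_mod_cast hp
    gcongr
  have hlen : 0 ≤ (w.length : ℝ) * mass ψ := by positivity
  rcases q with e | _ | _ | _
  · rcases Nat.le_succ_iff.1 hp with hp' | hp'
    · rw [stepSum_sweep _ w (hr p) (hρ p) hp']
      simp only [runtimePotential]
      have hcredit : credit α w (.sweep e) p ψ ≤ credit α w
          (.sweep (e && m == bitOf (scan w p))) (p + 1) (readOp m *ᵥ ψ) := by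
        by_cases h : ∃ s v x z, Tracks α w s v x z (.sweep e) ψ p
        · obtain ⟨s, v, x, z, h⟩ := h
          rw [h.credit_eq, (h.read m).credit_eq]
          simp only [Phase.swept, ← add_assoc, pow_succ (256 : ℝ)]
          simp [mul_pow]
          exact le_of_eq (by ring)
        · rw [credit, if_neg h]
          exact credit_nonneg
      have h1 := mass_readOp_le m ψ
      have h2 := mass_nonneg (readOp m *ᵥ ψ)
      have h3 := mul_le_mul_of_nonneg_left h1 (Nat.cast_nonneg (α := ℝ) w.length)
      have h4 : 0 ≤ (p : ℝ) * mass (readOp m *ᵥ ψ) := by positivity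
      linarith
    · have hp' : p = w.length + 1 := hp'
      have hmis := mass_nonneg (miscountOp *ᵥ ψ)
      have hTmis := mul_nonneg hT hmis
      have hpmis : 0 ≤ (p : ℝ) * mass (miscountOp *ᵥ ψ) := by positivity
      -- a wrong counter is detected with a probability that pays for the credit
      have hfault : ∀ {e : Bool} {s v : ℕ} {x : ℝ} {z : ℂ}, Tracks α w s v x z (.sweep e) ψ p →
          v ≠ s + 1 → credit α w (.sweep e) p ψ ≤ runtimeBound w * mass (miscountOp *ᵥ ψ) := by
        intro e s v x z h hv
        have h1 := h.credit_le hp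
        have h2 := mul_le_mul_of_nonneg_left (h.le_mass_miscountOp hv) hT
        have h3 := credit_nonneg (α := α) (w := w) (q := .sweep e) (p := p) (ψ := ψ)
        linarith
      cases e
      · rw [stepSum_shift _ w (hr p) (hρ p) hp']
        simp only [runtimePotential]
        have hcredit : credit α w (.sweep false) p ψ
            ≤ credit α w .rewind p (shiftOp α m *ᵥ ψ)
              + runtimeBound w * mass (miscountOp *ᵥ ψ) := by
          by_cases h : ∃ s v x z, Tracks α w s v x z (.sweep false) ψ p
          · obtain ⟨s, v, x, z, h⟩ := h
            by_cases hv : v = s + 1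
            · subst hv hp'
              rw [h.credit_eq, (h.shift m (w.length + 1)).credit_eq]
              have hexp : (s + 1) * (w.length + 2) + 0
                  = s * (w.length + 2) + (w.length + 1) + 1 := by ring
              simp only [Phase.swept, hexp, pow_succ (256 : ℝ) (s * (w.length + 2) + (w.length + 1))]
              simp [mul_pow]
              refine le_trans (le_of_eq ?_) (le_add_of_nonneg_right hTmis)
              ring
            · exact (hfault h hv).trans (le_add_of_nonneg_left credit_nonneg)
          · rw [credit, if_neg h]
            exact add_nonneg credit_nonneg hTmis
        have h1 := mass_shiftOp_le α.2 m ψ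
        have h2 := mass_nonneg (shiftOp α m *ᵥ ψ)
        have h3 := mul_le_mul_of_nonneg_left h1 (Nat.cast_nonneg (α := ℝ) w.length)
        linarith
      · rw [stepSum_verdict _ w (hr p) (hρ p) hp']
        simp only [runtimePotential]
        have hdig := mass_nonneg (misdigitOp α *ᵥ ψ)
        have hTdig := mul_nonneg hT hdig
        have hpdig : 0 ≤ (p : ℝ) * mass (misdigitOp α *ᵥ ψ) := by positivity
        have hacc := mass_nonneg (acceptOp *ᵥ ψ)
        have hTacc := mul_nonneg hT hacc
        have hpacc : 0 ≤ (p : ℝ) * mass (acceptOp *ᵥ ψ) := by positivity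
        have hcredit : credit α w (.sweep true) p ψ ≤ runtimeBound w * mass (acceptOp *ᵥ ψ) := by
          by_cases h : ∃ s v x z, Tracks α w s v x z (.sweep true) ψ p
          · obtain ⟨s, v, x, z, h⟩ := h
            have h1 := h.credit_le hp
            rw [mass_acceptOp, h.reg_zero]
            linarith
          · rw [credit, if_neg h]
            exact hTacc
        linarith
  · have hstart : credit α w .rewind 0 ψ ≤ credit α w (.sweep true) 0 ψ := by
      by_cases h : ∃ s v x z, Tracks α w s v x z .rewind ψ 0
      · obtain ⟨s, v, x, z, h⟩ := h
        exact (h.credit_eq.trans h.start.credit_eq.symm).le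
      · rw [credit, if_neg h]
        exact credit_nonneg
    cases p with
    | zero =>
      rw [stepSum_rewind_zero _ w (hr _) (hρ _)]
      simp only [runtimePotential, Nat.cast_zero]
      linarith
    | succ p =>
      rw [stepSum_rewind_succ _ w (hr _) (hρ _)]
      have : credit α w .rewind p ψ = credit α w .rewind (p + 1) ψ := rfl
      simp only [runtimePotential, this]
      push_cast
      linarith
  · exact absurd rfl hq.1
  · exact absurd rfl hq.2

theorem runtimeBound_le (w : List Bool) :
    runtimeBound w ≤ (2 : ℝ) ^ (2 ^ (2 * w.length + 6)) := by
  set n := w.length with hn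
  have h1 : (2 * ((n : ℝ) + 4)) ≤ 2 ^ (n + 4) := by
    have : n + 4 < 2 ^ (n + 3) := by
      have := Nat.lt_two_pow_self (n := n + 1)
      rw [show n + 3 = n + 1 + 2 by ring, pow_add _ (n + 1) 2]
      omega
    have h : 2 * (n + 4) ≤ 2 ^ (n + 4) := by
      rw [pow_succ 2 (n + 3)]
      omega
    exact_mod_cast h
  have h2 : n + 4 + 8 * (code w * (n + 2)) ≤ 2 ^ (2 * n + 6) := by
    have h3 : code w ≤ 2 ^ (n + 1) := (prefixCode_lt w _).le
    have h4 : n + 2 ≤ 2 ^ (n + 1) := Nat.lt_two_pow_self (n := n + 1)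
    have h5 := Nat.mul_le_mul h3 h4
    have h6 : 2 ^ (2 * n + 6) = 16 * (2 ^ (n + 1) * 2 ^ (n + 1)) := by ring
    have h7 : n + 4 ≤ 8 * (2 ^ (n + 1) * 2 ^ (n + 1)) := by nlinarith
    omega
  calc runtimeBound w = 2 * ((n : ℝ) + 4) * 2 ^ (8 * (code w * (n + 2))) := by
        rw [runtimeBound, pow_mul 2 8, ← hn]
        norm_num
    _ ≤ 2 ^ (n + 4) * 2 ^ (8 * (code w * (n + 2))) := by gcongr
    _ = 2 ^ (n + 4 + 8 * (code w * (n + 2))) := by rw [pow_add 2 (n + 4)]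
    _ ≤ _ := pow_le_pow_right₀ (by norm_num) h2

end Runtime

/-! ### The proof system -/

section ProofSystem

variable {w : List Bool} {d : ℕ → Bool}

theorem sum_ofReal_step (α : Set.Icc (0 : ℝ) (1 / 4)) (φ : Phase → ℕ → (Fin 4 → ℂ) → ℝ)
    (hφ : ∀ q p ψ, p ≤ w.length + 1 → 0 ≤ φ q p ψ) (c : Config (verifier α))
    (hc : c.head ≤ w.length + 1) (m : Bool) :
    ∑ i, ENNReal.ofReal (φ ((verifier α).step w c m i).state ((verifier α).step w c m i).head
        ((verifier α).step w c m i).reg)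
      = ENNReal.ofReal (stepSum α w φ c.state c.head c.reg m) := by
  rw [← ENNReal.ofReal_sum_of_nonneg]
  · rfl
  · intro i _
    exact hφ _ _ _ ((verifier α).step_head_le w hc m i)

theorem expectedRuntime_le (α : Set.Icc (0 : ℝ) (1 / 4)) (P : (verifier α).Prover) :
    (verifier α).expectedRuntime P w ≤ ENNReal.ofReal (runtimeBound w) := by
  refine ((verifier α).expectedRuntime_le_of_potential P w
    (fun c => ENNReal.ofReal (runtimePotential α w c.state c.head c.reg)) ?_).trans ?_
  · intro h hrun
    have hhead := (verifier α).run_head_le P w h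
    refine (congrArg (_ + ·) (sum_ofReal_step α (runtimePotential α w)
      (fun q p ψ hp => runtimePotential_nonneg hp q) _ hhead _)).trans_le ?_
    rw [Verifier.prob_eq, ← ENNReal.ofReal_add (mass_nonneg _)]
    · exact ENNReal.ofReal_le_ofReal (stepSum_runtimePotential_le α hhead hrun _)
    · exact Finset.sum_nonneg fun i _ =>
        runtimePotential_nonneg ((verifier α).step_head_le w hhead _ i) _
  · refine ENNReal.ofReal_le_ofReal ?_
    have ht := (tracks_single (α := α) (w := w) 0 1).start
    change runtimePotential α w (.sweep true) 0 (Pi.single 0 1) ≤ _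
    rw [runtimePotential, ht.credit_eq, mass_single]
    simp [Phase.swept]

theorem acceptProb_le (hd : d (code w) = false) (P : (verifier (encoding d)).Prover) :
    (verifier (encoding d)).acceptProb P w ≤ ENNReal.ofReal (1 / 3) := by
  refine ((verifier (encoding d)).acceptProb_le_of_potential P w
    (fun c => ENNReal.ofReal (soundPotential d w c.state c.head c.reg)) ?_ ?_).trans ?_
  · intro h hacc
    rw [Verifier.prob_eq, show (Verifier.run _ P w h).state = Phase.accept from hacc]
    exact le_rfl
  · intro h hrun
    have hhead := (verifier (encoding d)).run_head_le P w h
    exact (sum_ofReal_step _ (soundPotential d w) (fun q p ψ _ => soundPotential_nonneg q) _ hhead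
      _).trans_le (ENNReal.ofReal_le_ofReal (stepSum_soundPotential_le hd hhead hrun _))
  · have hs : Sound d w (.sweep true) 0 (Pi.single 0 1) :=
      ⟨0, 0, tail d 0, 1, (tracks_single 0 1).start, Or.inl rfl⟩
    refine ENNReal.ofReal_le_ofReal ?_
    change soundPotential d w (.sweep true) 0 (Pi.single 0 1) ≤ _
    rw [soundPotential_of_sound hs, mass_single]
    simp

/-- The symbols among which the honest prover chooses. -/
def HonestMsg (d : ℕ → Bool) (w : List Bool) (c : Config (verifier (encoding d))) (m : Bool) :
    Prop :=
  stepSum (encoding d) w honestPotential c.state c.head c.reg m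
      ≤ honestPotential c.state c.head c.reg ∧
    ∀ i, Honest d w ((verifier (encoding d)).step w c m i).state
      ((verifier (encoding d)).step w c m i).head ((verifier (encoding d)).step w c m i).reg

/-- The reply of the honest prover in a configuration. -/
noncomputable def honestReply (d : ℕ → Bool) (w : List Bool)
    (c : Config (verifier (encoding d))) : Bool :=
  Classical.epsilon (HonestMsg d w c)

/-- The configuration reached with the honest prover. The prover sees the outcomes and thus can
keep track of it. -/
noncomputable def honestRun (d : ℕ → Bool) (w : List Bool) :
    List Coin → Config (verifier (encoding d))
  | [] => (verifier (encoding d)).initConfig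
  | i :: h => (verifier (encoding d)).step w (honestRun d w h)
      (honestReply d w (honestRun d w h)) i

/-- The honest prover. -/
noncomputable def honestProver (d : ℕ → Bool) : (verifier (encoding d)).Prover :=
  fun w h => honestReply d w (honestRun d w h)

theorem run_honestProver (h : List Coin) :
    (verifier (encoding d)).run (honestProver d) w h = honestRun d w h := by
  induction h with
  | nil => rfl
  | cons i h ih =>
    change (verifier (encoding d)).step w ((verifier (encoding d)).run (honestProver d) w h) _ i
      = _
    rw [ih]
    rfl

theorem honestMsg_honestReply (hd : d (code w) = true) {c : Config (verifier (encoding d))}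
    (hhead : c.head ≤ w.length + 1) (hrun : (verifier (encoding d)).Running c)
    (hc : Honest d w c.state c.head c.reg) : HonestMsg d w c (honestReply d w c) :=
  Classical.epsilon_spec (exists_honest_msg hd hhead hrun hc)

theorem honest_honestRun (hd : d (code w) = true) (h : List Coin) :
    Honest d w (honestRun d w h).state (honestRun d w h).head (honestRun d w h).reg := by
  induction h with
  | nil =>
    have h0 : (0 + 1) / 2 ^ (w.length + 1 - 0) = 0 :=
      Nat.div_eq_of_lt (Nat.one_lt_two_pow (by omega))
    change ∃ s z, Tracks (tail d 0) w s ((s + 1) / 2 ^ (w.length + 1 - 0)) (tail d s) z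
      (.sweep true) (Pi.single 0 1) 0
    refine ⟨0, 1, ?_⟩
    rw [h0]
    exact (tracks_single 0 1).start
  | cons i h ih =>
    by_cases hrun : (verifier (encoding d)).Running (honestRun d w h)
    · have hhead := (verifier (encoding d)).run_head_le (honestProver d) w h
      rw [run_honestProver] at hhead
      exact (honestMsg_honestReply hd hhead hrun ih).2 i
    · rw [honestRun]
      generalize honestReply d w (honestRun d w h) = m
      generalize honestRun d w h = c at hrun
      have hhalt : c.state = Phase.accept ∨ c.state = Phase.reject := by
        by_contra hne
        exact hrun ⟨fun h1 => hne (Or.inl h1), fun h2 => hne (Or.inr h2)⟩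
      change Honest d w (nextPhase c.state (scan w c.head) m i).1 _ _
      rcases hhalt with h1 | h1 <;> rw [h1] <;> trivial

theorem rejectProb_honestProver_le (hd : d (code w) = true) :
    (verifier (encoding d)).rejectProb (honestProver d) w ≤ ENNReal.ofReal (1 / 3) := by
  refine ((verifier (encoding d)).rejectProb_le_of_potential (honestProver d) w
    (fun c => ENNReal.ofReal (honestPotential c.state c.head c.reg)) ?_ ?_).trans ?_
  · intro h hrej
    rw [Verifier.prob_eq, show (Verifier.run _ _ w h).state = Phase.reject from hrej]
    exact le_rfl
  · intro h hrun
    have hhead := (verifier (encoding d)).run_head_le (honestProver d) w h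
    have hmsg : HonestMsg d w ((verifier (encoding d)).run (honestProver d) w h)
        (honestReply d w (honestRun d w h)) := by
      rw [show (verifier (encoding d)).run (honestProver d) w h = honestRun d w h from
        run_honestProver h] at hrun hhead ⊢
      exact honestMsg_honestReply hd hhead hrun (honest_honestRun hd h)
    exact (sum_ofReal_step _ honestPotential (fun q p ψ _ => honestPotential_nonneg q) _ hhead
      _).trans_le (ENNReal.ofReal_le_ofReal hmsg.1)
  · refine ENNReal.ofReal_le_ofReal ?_
    change honestPotential (.sweep true) 0 (Pi.single 0 1) ≤ _
    simp [honestPotential, mass_single]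

theorem two_thirds_le {a b : ℝ≥0∞} (h : 1 ≤ a + b) (ha : a ≤ ENNReal.ofReal (1 / 3)) :
    ENNReal.ofReal (1 - 1 / 3) ≤ b := by
  rw [ENNReal.ofReal_sub _ (by norm_num), ENNReal.ofReal_one, tsub_le_iff_left]
  exact h.trans (by gcongr)

end ProofSystem

end QCFA

theorem theorem3 (L : Language Bool) :
    ∃ (V : QCFA.Verifier Bool 4) (P : V.Prover),
      V.IsBoundedErrorProofSystem P L ∧
      ∃ f : ℕ → ℕ,
        Asymptotics.IsBigO Filter.atTop (fun n : ℕ => (f n : ℝ)) (fun n : ℕ => (n : ℝ)) ∧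
        ∀ (P' : V.Prover) (w : List Bool),
          V.expectedRuntime P' w ≤ (2 : ℝ≥0∞) ^ (2 ^ f w.length) := by
  classical
  let d : ℕ → Bool := fun t => decide (∃ w ∈ L, QCFA.code w = t)
  have hd : ∀ w, d (QCFA.code w) = decide (w ∈ L) := fun w => by
    simp [d, QCFA.code_injective.eq_iff]
  have htime : ∀ (P' : (QCFA.verifier (QCFA.encoding d)).Prover) (w : List Bool),
      (QCFA.verifier (QCFA.encoding d)).expectedRuntime P' w
        ≤ (2 : ℝ≥0∞) ^ (2 ^ (2 * w.length + 6)) := fun P' w => by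
    refine (QCFA.expectedRuntime_le _ P').trans
      ((ENNReal.ofReal_le_ofReal (QCFA.runtimeBound_le w)).trans (le_of_eq ?_))
    rw [ENNReal.ofReal_pow (by norm_num)]
    norm_num
  have hhalt : ∀ (P' : (QCFA.verifier (QCFA.encoding d)).Prover) (w : List Bool),
      1 ≤ (QCFA.verifier (QCFA.encoding d)).acceptProb P' w
        + (QCFA.verifier (QCFA.encoding d)).rejectProb P' w := fun P' w =>
    QCFA.Verifier.one_le_acceptProb_add_rejectProb _ P' w
      (ne_top_of_le_ne_top (by finiteness) (htime P' w))
  refine ⟨QCFA.verifier (QCFA.encoding d), QCFA.honestProver d,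
    ⟨1 / 3, by norm_num, by norm_num, fun w hw => ?_, fun w hw P' => ?_⟩,
    fun n => 2 * n + 6, ?_, htime⟩
  · refine QCFA.two_thirds_le ((hhalt _ w).trans_eq (add_comm _ _))
      (QCFA.rejectProb_honestProver_le ?_)
    simp [hd, hw]
  · exact QCFA.two_thirds_le (hhalt P' w) (QCFA.acceptProb_le (by simp [hd, hw]) P')
  · refine Asymptotics.IsBigO.of_bound 8 ?_
    filter_upwards [Filter.eventually_ge_atTop 1] with n hn
    have : (1 : ℝ) ≤ n := by exact_mod_cast hn
    rw [Real.norm_of_nonneg (by positivity), Real.norm_of_nonneg (by positivity)]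
    push_cast
    linarith
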